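/- Let $\mu(G)$ denote the path cover number of a finite graph $G$: $\mu(G)=0$ if $G$ is Hamiltonian, and otherwise $\mu(G)$ is the minimal $k$ such that $V(G)$ can be covered by $k$ vertex-disjoint paths (paths consisting of a single vertex are allowed). For every $\varepsilon>0$ there is a constant $c_0=c_0(\varepsilon)>0$ such that for every fixed real $c\ge c_0$ and $G\sim G(n,c/n)$ the following holds with probability tending to $1$ as $n\to\infty$: $$(1-\varepsilon)\cdot\tfrac12 ce^{-c}\cdot n\;\le\;\mu(G)\;\le\;(1+\varepsilon)\cdot\tfrac12 ce^{-c}\cdot n .$$ Equivalently, with probability tending to $1$ as $n\to\infty$, there is a graph $H$ on $V(G)$ with at most $(1+\varepsilon)\cdot\frac12 ce^{-c}n$ edges such that $G\cup H$ is Hamiltonian, and every graph $H$ on $V(G)$ such that $G\cup H$ is Hamiltonian has at least $(1-\varepsilon)\cdot\frac12 ce^{-c}n$ edges. -/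

import Mathlib

open Filter Topology MeasureTheory

namespace SimpleGraph

/-- The vertex set of `G` can be covered by `k` vertex-disjoint paths of `G`: there are `k` paths
such that every vertex lies on exactly one of them. Paths of length `0` (single vertices) are
allowed. -/
def HasPathCover {V : Type*} (G : SimpleGraph V) (k : ℕ) : Prop :=
  ∃ (s t : Fin k → V) (p : ∀ i, G.Walk (s i) (t i)),
    (∀ i, (p i).IsPath) ∧ ∀ v, ∃! i, v ∈ (p i).support

/-- Covering by single vertices is always possible, so the minimum in the path cover number is
over a non-empty set. -/
theorem hasPathCover_card {V : Type*} [Fintype V] (G : SimpleGraph V) :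
    G.HasPathCover (Fintype.card V) := by
  let e := (Fintype.equivFin V).symm
  refine ⟨e, e, fun i => Walk.nil, fun i => Walk.IsPath.nil, fun v => ⟨e.symm v, ?_, ?_⟩⟩
  · simp
  · intro i hi
    have h : v = e i := by simpa using hi
    simp [h]

open Classical in
/-- The path cover number `μ(G)`: it is `0` if `G` is Hamiltonian, and otherwise the minimal `k`
such that the vertex set can be covered by `k` vertex-disjoint paths. -/
noncomputable def pathCoverNumber {V : Type*} [Fintype V] (G : SimpleGraph V) : ℕ :=
  if G.IsHamiltonian then 0 else sInf {k : ℕ | G.HasPathCover k}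

/-- The law of the random graph `G(n, p)` on the vertex set `Fin n`. For `p` outside `[0, 1]` the
edge probability is the nearest point of `[0, 1]`. -/
noncomputable def gnp (n : ℕ) (p : ℝ) : Measure (SimpleGraph (Fin n)) :=
  binomialRandom (Fin n) (Set.projIcc (0 : ℝ) 1 zero_le_one p)

end SimpleGraph

/-!
Write `X` for the number of vertices of degree one. Each of them is an endpoint of its path in every
path cover, and is incident to an edge of `H` whenever `G ⊔ H` is Hamiltonian, so `X ≤ 2 μ(G)` and
`X ≤ 2 |E(H)|` (`card_degree_eq_one_le_pathCoverNumber`, `card_degree_eq_one_le_of_isHamiltonian`).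
As `X` has mean `(1 + o(1)) c e⁻ᶜ n` and bounded increments, this proves the lower bounds.

For the upper bounds an error that is linear in `n` with a small factor is allowed, and hence no
rotations or boosters are needed: a subgraph of maximum degree two that misses few edges and has few
cycles suffices. Such a subgraph comes from a flow on the bipartite double cover of `G` in which
every vertex has out- and in-capacity two and every arc has capacity one. If every cut has capacity
at least `2 n - d`, Hall's theorem gives an integral flow of that value (`exists_flow`). Doubling
each vertex once more, its arcs form paths and cycles; keeping every other edge of them leaves a
subgraph of `G` of maximum degree two which misses about `d` units of degree. Only odd cycles lose,
and these are long or contain a short odd cycle of `G` (`exists_two_matching`). The components of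
the subgraph are paths, which account for two units of missing degree each, and cycles, of which few
are long and few are short since `G` has only boundedly many short cycles in expectation
(`exists_cover_of_cut`).

The cut condition holds with `d = defect + lowExcess k`, where `defect` is `∑ (2 - deg v)⁺` and
`lowExcess k` counts the neighbours of degree at most `k` beyond the first one of each vertex. Small
vertex sets are covered by local sparsity, large ones by a crude edge count (`cut_le`). The mean of
`defect` is about `(c + 2) e⁻ᶜ n`, whereas that of `lowExcess ⌊c / 15⌋` is of smaller order, since
it requires two vertices of low degree, which costs a factor of at most `exp (-7 c / 5)`
(`edgeExp_lowExcess_le`). All three parameters have bounded increments, hence they are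
concentrated by the Efron–Stein inequality (`edgeProb_abs_sub_ge_le`), and about `d / 2` paths, that
is `c e⁻ᶜ n / 2`, suffice.
-/

/-! ### Graphs of maximum degree two -/

namespace SimpleGraph

/-- A list of pairwise distinct vertices, at least three of them, tracing a cycle of `G`. -/
def IsCycleList {V : Type*} (G : SimpleGraph V) (l : List V) : Prop :=
  l.Nodup ∧ 3 ≤ l.length ∧ l.IsChain G.Adj ∧
    ∃ a ∈ l.head?, ∃ b ∈ l.getLast?, G.Adj b a

section Components

variable {V : Type*}

theorem eq_or_eq_of_degree_le_two [Fintype V] {F : SimpleGraph V} [DecidableRel F.Adj]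
    (hF : ∀ v, F.degree v ≤ 2) {v a b w : V} (ha : F.Adj v a) (hb : F.Adj v b) (hab : a ≠ b)
    (hw : F.Adj v w) : w = a ∨ w = b := by
  classical
  by_contra! h
  have hsub : ({a, b, w} : Finset V) ⊆ F.neighborFinset v := by
    intro x hx
    simp only [Finset.mem_insert, Finset.mem_singleton] at hx
    rcases hx with rfl | rfl | rfl <;> simpa
  have h3 : ({a, b, w} : Finset V).card = 3 := by
    rw [Finset.card_eq_three]
    exact ⟨a, b, w, hab, h.1.symm, h.2.symm, rfl⟩
  have := Finset.card_le_card hsub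
  rw [h3, card_neighborFinset_eq_degree] at this
  have := hF v
  omega

/-- In a graph of maximum degree at most two, every nonempty set of vertices closed under adjacency
contains a component traced by a path; that path either misses at least two units of degree, or
closes up to a cycle. -/
theorem exists_component_list [Fintype V] (F : SimpleGraph V) [DecidableRel F.Adj]
    (hF : ∀ v, F.degree v ≤ 2) (U : Finset V) (hU : U.Nonempty)
    (hcl : ∀ v ∈ U, ∀ w, F.Adj v w → w ∈ U) :
    ∃ l : List V, l ≠ [] ∧ l.Nodup ∧ l.IsChain F.Adj ∧ (∀ v ∈ l, v ∈ U) ∧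
      (∀ v ∈ l, ∀ w, F.Adj v w → w ∈ l) ∧
      (2 ≤ (l.map fun v => 2 - F.degree v).sum ∨ F.IsCycleList l) := by
  classical
  -- a longest path inside `U`
  let P : ℕ → Prop := fun m => ∃ l : List V, l.length = m ∧ l ≠ [] ∧ l.Nodup ∧
    l.IsChain F.Adj ∧ ∀ v ∈ l, v ∈ U
  have hP1 : P 1 := by
    obtain ⟨u, hu⟩ := hU
    exact ⟨[u], by simp, by simp, by simp, by simp, by simpa⟩
  have hPb : ∀ m, P m → m ≤ Fintype.card V := by
    rintro m ⟨l, rfl, -, hn, -⟩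
    exact hn.length_le_card
  let M := Nat.findGreatest P (Fintype.card V)
  have hM : P M := Nat.findGreatest_spec (hPb 1 hP1) hP1
  have hMmax : ∀ m, P m → m ≤ M := fun m hm => Nat.le_findGreatest (hPb m hm) hm
  obtain ⟨l, hlen, hne, hnd, hch, hlU⟩ := hM
  have hhead : ∀ w, F.Adj (l.head hne) w → w ∈ l := by
    intro w hw
    by_contra hwl
    have : P (M + 1) := by
      refine ⟨w :: l, by simp [hlen], by simp, by simp [hwl, hnd], ?_, ?_⟩
      · rw [List.isChain_cons]
        refine ⟨?_, hch⟩
        intro y hy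
        rw [List.head?_eq_some_head hne] at hy
        simp at hy
        subst hy
        exact hw.symm
      · intro v hv
        rcases List.mem_cons.1 hv with rfl | hv
        · exact hcl _ (hlU _ (List.head_mem hne)) _ hw
        · exact hlU _ hv
    have := hMmax _ this
    omega
  have hlast : ∀ w, F.Adj (l.getLast hne) w → w ∈ l := by
    intro w hw
    by_contra hwl
    have : P (M + 1) := by
      refine ⟨l ++ [w], by simp [hlen], by simp, ?_, ?_, ?_⟩
      · rw [List.nodup_append]
        refine ⟨hnd, by simp, ?_⟩
        intro a ha b hb
        simp at hb
        subst hb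
        rintro rfl
        exact hwl ha
      · rw [List.isChain_append]
        refine ⟨hch, by simp, ?_⟩
        intro x hx y hy
        rw [List.getLast?_eq_some_getLast hne] at hx
        simp at hx hy
        subst hx; subst hy
        exact hw
      · intro v hv
        rcases List.mem_append.1 hv with hv | hv
        · exact hlU _ hv
        · simp at hv
          subst hv
          exact hcl _ (hlU _ (List.getLast_mem hne)) _ hw
    have := hMmax _ this
    omega
  have hadj : ∀ i (hi : i + 1 < l.length), F.Adj l[i] l[i + 1] := fun i hi =>
    List.isChain_iff_getElem.1 hch i hi
  have hinj : ∀ {i j} (hi : i < l.length) (hj : j < l.length), l[i] = l[j] → i = j :=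
    fun hi hj h => (hnd.getElem_inj_iff).1 h
  -- an inner vertex has its two neighbours on the path already
  have hint : ∀ i (h0 : 0 < i) (hi : i + 1 < l.length), ∀ w, F.Adj l[i] w →
      w = l[i - 1] ∨ w = l[i + 1] := by
    intro i h0 hi w hw
    refine eq_or_eq_of_degree_le_two hF ?_ (hadj i hi) ?_ hw
    · have := hadj (i - 1) (by omega)
      simp only [Nat.sub_add_cancel h0] at this
      exact this.symm
    · intro h
      have := hinj _ _ h
      omega
  have hclosed : ∀ v ∈ l, ∀ w, F.Adj v w → w ∈ l := by
    intro v hv w hw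
    obtain ⟨i, hi, rfl⟩ := List.getElem_of_mem hv
    by_cases h0 : i = 0
    · subst h0
      apply hhead
      rwa [List.head_eq_getElem]
    by_cases h1 : i + 1 < l.length
    · rcases hint i (by omega) h1 w hw with h | h <;> rw [h] <;> exact List.getElem_mem _
    · apply hlast
      rw [List.getLast_eq_getElem]
      have : l.length - 1 = i := by omega
      simpa only [this] using hw
  refine ⟨l, hne, hnd, hch, hlU, hclosed, ?_⟩
  by_cases hlen1 : l.length = 1
  · left
    obtain ⟨a, rfl⟩ := List.length_eq_one_iff.1 hlen1
    have : F.degree a = 0 := by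
      rw [← card_neighborFinset_eq_degree, Finset.card_eq_zero, Finset.eq_empty_iff_forall_notMem]
      intro w hw
      have hw' : F.Adj a w := by simpa using hw
      have := hclosed a (by simp) w hw'
      simp at this
      subst this
      exact F.irrefl hw'
    simp [this]
  have hpos : 0 < l.length := List.length_pos_iff.2 hne
  by_cases hends : F.degree l[0] ≤ 1 ∧ F.degree l[l.length - 1] ≤ 1
  · left
    rw [← List.sum_toFinset _ hnd]
    have hsub : ({l[0], l[l.length - 1]} : Finset V) ⊆ l.toFinset := by
      intro x hx
      simp only [Finset.mem_insert, Finset.mem_singleton] at hx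
      rcases hx with rfl | rfl <;> simp
    refine le_trans ?_ (Finset.sum_le_sum_of_subset hsub)
    rw [Finset.sum_pair]
    · omega
    · intro h
      have := hinj _ _ h
      omega
  right
  -- an endpoint of degree two can only be adjacent to the other endpoint
  have key : ∃ (i j : ℕ) (hi : i < l.length) (hj : j < l.length),
      ((i = 0 ∧ (j + 1 ≠ 1) ∧ j ≠ 1) ∨ (i = l.length - 1 ∧ j + 1 ≠ i ∧ i ≠ 0)) ∧
      F.Adj l[i] l[j] := by
    have h2 : ∀ v u, 1 < F.degree v → ∃ w, F.Adj v w ∧ w ≠ u := by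
      intro v u hv
      rw [← card_neighborFinset_eq_degree] at hv
      obtain ⟨w, hw, hwu⟩ := Finset.exists_mem_ne hv u
      exact ⟨w, by simpa using hw, hwu⟩
    rw [not_and_or] at hends
    rcases hends with h | h
    · obtain ⟨w, hw, hwu⟩ := h2 _ l[1] (not_le.1 h)
      obtain ⟨j, hj, rfl⟩ := List.getElem_of_mem (hclosed _ (List.getElem_mem _) w hw)
      refine ⟨0, j, hpos, hj, Or.inl ⟨rfl, ?_, ?_⟩, hw⟩
      · rintro h
        have : j = 0 := by omega
        subst this
        exact F.irrefl hw
      · rintro rfl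
        exact hwu rfl
    · obtain ⟨w, hw, hwu⟩ := h2 _ l[l.length - 2] (not_le.1 h)
      obtain ⟨j, hj, rfl⟩ := List.getElem_of_mem (hclosed _ (List.getElem_mem _) w hw)
      refine ⟨l.length - 1, j, by omega, hj, Or.inr ⟨rfl, ?_, by omega⟩, hw⟩
      rintro h
      have : j = l.length - 2 := by omega
      subst this
      exact hwu rfl
  obtain ⟨i, j, hi, hj, hij, hadjij⟩ := key
  have hends2 : F.Adj l[l.length - 1] l[0] ∧ 3 ≤ l.length := by
    rcases hij with ⟨rfl, h1, h2⟩ | ⟨rfl, h1, h2⟩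
    · by_cases hjl : j + 1 < l.length
      · rcases hint j (by omega) hjl _ hadjij.symm with h | h <;> have := hinj _ _ h <;> omega
      · have : j = l.length - 1 := by omega
        subst this
        exact ⟨hadjij.symm, by omega⟩
    · have hjne : j ≠ l.length - 1 := by
        rintro rfl
        exact F.irrefl hadjij
      by_cases hj0 : j = 0
      · subst hj0
        exact ⟨hadjij, by omega⟩
      · rcases hint j (by omega) (by omega) _ hadjij.symm with h | h <;>
          have := hinj _ _ h <;> omega
  refine ⟨hnd, hends2.2, hch, l[0], ?_, l[l.length - 1], ?_, hends2.1⟩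
  · simp [List.head?_eq_getElem?]
  · simp [List.getLast?_eq_getElem?]

/-- A graph of maximum degree at most two decomposes into components, each traced by a path. -/
theorem exists_component_lists [Fintype V] (F : SimpleGraph V) [DecidableRel F.Adj]
    (hF : ∀ v, F.degree v ≤ 2) :
    ∃ ls : List (List V), ls.flatten.Nodup ∧ (∀ v, v ∈ ls.flatten) ∧
      ∀ l ∈ ls, l ≠ [] ∧ l.Nodup ∧ l.IsChain F.Adj ∧ (∀ v ∈ l, ∀ w, F.Adj v w → w ∈ l) ∧
        (2 ≤ (l.map fun v => 2 - F.degree v).sum ∨ F.IsCycleList l) := by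
  classical
  have key : ∀ (m : ℕ) (U : Finset V), U.card = m → (∀ v ∈ U, ∀ w, F.Adj v w → w ∈ U) →
      ∃ ls : List (List V), ls.flatten.Nodup ∧ (∀ v, v ∈ ls.flatten ↔ v ∈ U) ∧
      ∀ l ∈ ls, l ≠ [] ∧ l.Nodup ∧ l.IsChain F.Adj ∧ (∀ v ∈ l, ∀ w, F.Adj v w → w ∈ l) ∧
        (2 ≤ (l.map fun v => 2 - F.degree v).sum ∨ F.IsCycleList l) := by
    intro m
    induction m using Nat.strong_induction_on with
    | _ m ih =>
      intro U hUm hcl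
      rcases U.eq_empty_or_nonempty with rfl | hU
      · exact ⟨[], by simp, by simp, by simp⟩
      obtain ⟨l, hne, hnd, hch, hlU, hlcl, hdeg⟩ := exists_component_list F hF U hU hcl
      have hlt : (U \ l.toFinset).card < m := by
        rw [← hUm]
        apply Finset.card_lt_card
        rw [Finset.ssubset_iff_of_subset Finset.sdiff_subset]
        exact ⟨l.head hne, hlU _ (List.head_mem hne), by simp⟩
      obtain ⟨ls, h1, h2, h3⟩ := ih _ hlt (U \ l.toFinset) rfl (by
        intro v hv w hw
        simp only [Finset.mem_sdiff, List.mem_toFinset] at hv ⊢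
        exact ⟨hcl v hv.1 w hw, fun hwl => hv.2 (hlcl w hwl v hw.symm)⟩)
      refine ⟨l :: ls, ?_, ?_, ?_⟩
      · rw [List.flatten_cons, List.nodup_append]
        refine ⟨hnd, h1, ?_⟩
        rintro a ha b hb rfl
        have := (h2 a).1 hb
        simp [ha] at this
      · intro v
        rw [List.flatten_cons, List.mem_append, h2]
        simp only [Finset.mem_sdiff, List.mem_toFinset]
        constructor
        · rintro (h | h)
          · exact hlU v h
          · exact h.1
        · intro h
          by_cases hv : v ∈ l
          · exact Or.inl hv
          · exact Or.inr ⟨h, hv⟩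
      · intro l' hl'
        rcases List.mem_cons.1 hl' with rfl | hl'
        · exact ⟨hne, hnd, hch, hlcl, hdeg⟩
        · exact h3 l' hl'
  obtain ⟨ls, h1, h2, h3⟩ := key _ Finset.univ rfl (by simp)
  exact ⟨ls, h1, by simpa using h2, h3⟩

/-- Weights on disjoint lists that are dominated by sums of `f` over them add up to at most the sum
of `f` over all vertices. -/
theorem sum_map_le_sum_of_flatten [Fintype V] {ls : List (List V)} (hnd : ls.flatten.Nodup)
    (f : V → ℕ) (g : List V → ℕ) (hg : ∀ l ∈ ls, g l ≤ (l.map f).sum) :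
    (ls.map g).sum ≤ ∑ v, f v := by
  classical
  have h1 : (ls.map g).sum ≤ (ls.map fun l => (l.map f).sum).sum := List.sum_le_sum hg
  have h2 : (ls.map fun l => (l.map f).sum).sum = (ls.flatten.map f).sum := by
    rw [List.map_flatten, List.sum_flatten, List.map_map]
    rfl
  rw [h2, ← List.sum_toFinset _ hnd] at h1
  exact h1.trans (Finset.sum_le_sum_of_subset (Finset.subset_univ _))

/-- In a graph of maximum degree at most two, cycles of length at most `L` meeting `Z`, the number
of components is controlled by the missing degree, the long cycles and the short cycles. -/
theorem exists_path_lists [Fintype V] (F : SimpleGraph V) [DecidableRel F.Adj] [DecidableEq V]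
    (hF : ∀ v, F.degree v ≤ 2) (L : ℕ) (Z : Finset V)
    (hZ : ∀ l, F.IsCycleList l → l.length ≤ L → ∃ v ∈ l, v ∈ Z) :
    ∃ ls : List (List V), ls.flatten.Nodup ∧ (∀ v, v ∈ ls.flatten) ∧
      (∀ l ∈ ls, l ≠ [] ∧ l.IsChain F.Adj) ∧
      2 * L * ls.length ≤ L * (∑ v, (2 - F.degree v)) + 2 * Fintype.card V + 2 * L * Z.card := by
  obtain ⟨ls, h1, h2, h3⟩ := exists_component_lists F hF
  refine ⟨ls, h1, h2, fun l hl => ⟨(h3 l hl).1, (h3 l hl).2.2.1⟩, ?_⟩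
  -- A component receives weight `2 * L` from its missing degree if it is a path, from its many
  -- vertices if it is a long cycle, and from a vertex of `Z` if it is a short cycle.
  have := sum_map_le_sum_of_flatten h1
    (fun v => L * (2 - F.degree v) + 2 * (1 + L * if v ∈ Z then 1 else 0)) (fun _ => 2 * L) (by
      intro l hl
      obtain ⟨-, -, -, -, h | h⟩ := h3 l hl
      · rw [List.sum_map_add, List.sum_map_mul_left]
        have := Nat.mul_le_mul_left L h
        omega
      · rw [List.sum_map_add, List.sum_map_mul_left, List.sum_map_mul_left, List.sum_map_add,
          List.sum_map_mul_left]
        have : L ≤ l.length ∨ 1 ≤ (l.map fun v => if v ∈ Z then 1 else 0).sum := by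
          by_cases hl' : l.length ≤ L
          · right
            obtain ⟨v, hv, hvZ⟩ := hZ l h hl'
            have := List.single_le_sum (l := l.map fun v => if v ∈ Z then 1 else 0) (by simp) 1
              (List.mem_map.2 ⟨v, hv, by simp [hvZ]⟩)
            exact this
          · left; omega
        simp only [List.map_const', List.sum_replicate, smul_eq_mul, mul_one]
        rcases this with h | h
        · have := Nat.zero_le (L * (l.map fun v => 2 - F.degree v).sum)
          have := Nat.zero_le (L * (l.map fun v => if v ∈ Z then 1 else 0).sum)
          omega
        · have := Nat.mul_le_mul_left L h
          have := Nat.zero_le (L * (l.map fun v => 2 - F.degree v).sum)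
          omega)
  simp only [List.map_const', List.sum_replicate, smul_eq_mul, Finset.sum_add_distrib,
    ← Finset.mul_sum, Finset.sum_const, Finset.card_univ, mul_one, Finset.sum_ite_mem,
    Finset.univ_inter] at this
  nlinarith

end Components

end SimpleGraph

/-! ### Flows on the bipartite double cover -/

namespace SimpleGraph

section Flow

open Classical in
/-- The integral flow on the bipartite double cover of `G` with capacity two at every vertex and
one at every edge, obtained from Hall's theorem: if every cut has capacity at least `2 * n - d`,
then some set of ordered adjacent pairs with all out- and in-degrees at most two has at least
`2 * n - d` elements. -/
theorem exists_flow {V : Type*} [Fintype V] (G : SimpleGraph V) (d : ℕ)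
    (h : ∀ A B : Finset V, 2 * A.card ≤ (G.interedges A Bᶜ).card + 2 * B.card + d) :
    ∃ R : Finset (V × V), (∀ e ∈ R, G.Adj e.1 e.2) ∧
      (∀ u, (R.filter fun e => e.1 = u).card ≤ 2) ∧
      (∀ v, (R.filter fun e => e.2 = v).card ≤ 2) ∧ 2 * Fintype.card V ≤ R.card + d := by
  -- A unit of flow leaving `u` is matched to a pair `e` starting at `u`; then `e` itself has to be
  -- matched to one of the two slots at its head, which enforces all the capacities.
  let E := {e : V × V // G.Adj e.1 e.2}
  let r : (V × Bool) ⊕ E → E ⊕ ((V × Bool) ⊕ Fin d) → Prop := fun a b =>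
    match a, b with
    | Sum.inl x, Sum.inl e => e.1.1 = x.1
    | Sum.inl _, Sum.inr (Sum.inl _) => False
    | Sum.inl _, Sum.inr (Sum.inr _) => True
    | Sum.inr e, Sum.inl e' => e' = e
    | Sum.inr e, Sum.inr (Sum.inl y) => e.1.2 = y.1
    | Sum.inr _, Sum.inr (Sum.inr _) => False
  have hall : ∀ S : Finset ((V × Bool) ⊕ E),
      S.card ≤ (Finset.univ.filter fun b => ∃ a ∈ S, r a b).card := by
    intro S
    set N := Finset.univ.filter fun b => ∃ a ∈ S, r a b with hN
    rw [← Finset.card_toLeft_add_card_toRight (u := S),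
      ← Finset.card_toLeft_add_card_toRight (u := N),
      ← Finset.card_toLeft_add_card_toRight (u := N.toRight)]
    set A := S.toLeft.image Prod.fst with hA
    set B := S.toRight.image (fun e => e.1.2) with hB
    have h1 : S.toLeft.card ≤ 2 * A.card := by
      have : S.toLeft ⊆ A ×ˢ (Finset.univ : Finset Bool) := by
        intro x hx
        simp only [Finset.mem_product, Finset.mem_univ, and_true]
        exact Finset.mem_image_of_mem _ hx
      have := Finset.card_le_card this
      rw [Finset.card_product] at this
      simp at this
      omega
    have h2 : 2 * B.card ≤ N.toRight.toLeft.card := by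
      have : B ×ˢ (Finset.univ : Finset Bool) ⊆ N.toRight.toLeft := by
        rintro ⟨v, j⟩ hx
        simp only [Finset.mem_product, Finset.mem_univ, and_true] at hx
        obtain ⟨e, he, hev⟩ := Finset.mem_image.1 hx
        simp only [Finset.mem_toLeft, Finset.mem_toRight, hN, Finset.mem_filter, Finset.mem_univ,
          true_and]
        exact ⟨Sum.inr e, Finset.mem_toRight.1 he, hev⟩
      have := Finset.card_le_card this
      rw [Finset.card_product] at this
      simp at this
      omega
    have h3 : S.toRight.card ≤ N.toLeft.card := by
      apply Finset.card_le_card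
      intro e he
      simp only [Finset.mem_toLeft, hN, Finset.mem_filter, Finset.mem_univ, true_and]
      exact ⟨Sum.inr e, Finset.mem_toRight.1 he, rfl⟩
    rcases S.toLeft.eq_empty_or_nonempty with h0 | ⟨x0, hx0⟩
    · rw [h0]
      simp
      omega
    have h4 : N.toRight.toRight.card = d := by
      have : N.toRight.toRight = Finset.univ := by
        rw [Finset.eq_univ_iff_forall]
        intro i
        simp only [Finset.mem_toRight, hN, Finset.mem_filter, Finset.mem_univ, true_and]
        exact ⟨Sum.inl x0, Finset.mem_toLeft.1 hx0, trivial⟩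
      rw [this]
      simp
    have h5 : S.toRight.card + (G.interedges A Bᶜ).card ≤ N.toLeft.card := by
      have hc : (G.interedges A Bᶜ).card =
          (Finset.univ.filter fun e : E => e.1.1 ∈ A ∧ e.1.2 ∉ B).card := by
        rw [← Finset.card_map (Function.Embedding.subtype _)]
        congr 1
        ext ⟨a, b⟩
        simp only [mem_interedges_iff, Finset.mem_compl, Finset.mem_map, Finset.mem_filter,
          Finset.mem_univ, true_and, Function.Embedding.coe_subtype]
        constructor
        · rintro ⟨h1, h2, h3⟩
          exact ⟨⟨(a, b), h3⟩, ⟨h1, h2⟩, rfl⟩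
        · rintro ⟨e, ⟨h1, h2⟩, h3⟩
          have := e.2
          rw [h3] at h1 h2 this
          exact ⟨h1, h2, this⟩
      rw [hc, ← Finset.card_union_of_disjoint]
      · apply Finset.card_le_card
        intro e he
        simp only [Finset.mem_toLeft, hN, Finset.mem_filter, Finset.mem_univ, true_and]
        rcases Finset.mem_union.1 he with he | he
        · exact ⟨Sum.inr e, Finset.mem_toRight.1 he, rfl⟩
        · simp only [Finset.mem_filter, Finset.mem_univ, true_and] at he
          obtain ⟨x, hx, hxe⟩ := Finset.mem_image.1 he.1
          exact ⟨Sum.inl x, Finset.mem_toLeft.1 hx, hxe.symm⟩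
      · rw [Finset.disjoint_left]
        intro e he he'
        simp only [Finset.mem_filter, Finset.mem_univ, true_and] at he'
        exact he'.2 (Finset.mem_image_of_mem _ he)
    have := h A B
    omega
  obtain ⟨f, hf, hfr⟩ := (Fintype.all_card_le_filter_rel_iff_exists_injective r).1 hall
  let T := Finset.univ.filter fun e : E => ∃ x, f (Sum.inl x) = Sum.inl e
  have hT : ∀ e ∈ T, ∃ j, f (Sum.inr e) = Sum.inr (Sum.inl (e.1.2, j)) := by
    intro e he
    simp only [T, Finset.mem_filter, Finset.mem_univ, true_and] at he
    obtain ⟨x, hx⟩ := he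
    have h1 := hfr (Sum.inr e)
    rcases hfe : f (Sum.inr e) with e' | ⟨y, j⟩ | i
    · rw [hfe] at h1
      have h1' : e' = e := h1
      rw [h1', ← hx] at hfe
      exact absurd (hf hfe) (by simp)
    · rw [hfe] at h1
      have h1' : e.1.2 = y := h1
      exact ⟨j, by rw [h1']⟩
    · rw [hfe] at h1
      exact absurd h1 (by simp [r])
  refine ⟨T.map (Function.Embedding.subtype _), ?_, ?_, ?_, ?_⟩
  · intro e he
    obtain ⟨e', -, rfl⟩ := Finset.mem_map.1 he
    exact e'.2
  · intro u
    rw [Finset.filter_map, Finset.card_map]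
    have : ∀ e ∈ T.filter ((fun e : V × V => e.1 = u) ∘ (Function.Embedding.subtype _)),
        ∃ i, f (Sum.inl (u, i)) = Sum.inl e := by
      intro e he
      simp only [Finset.mem_filter, T, Finset.mem_univ, true_and, Function.comp] at he
      obtain ⟨⟨⟨w, i⟩, hx⟩, heu⟩ := he
      have h1 := hfr (Sum.inl (w, i))
      rw [hx] at h1
      have h1' : e.1.1 = w := h1
      have heu' : e.1.1 = u := heu
      refine ⟨i, ?_⟩
      rw [← heu', h1', hx]
    choose! g hg using this
    have := Finset.card_le_card_of_injOn (t := (Finset.univ : Finset Bool)) g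
      (fun _ _ => Finset.mem_coe.2 (Finset.mem_univ _)) (by
      intro e he e' he' hee'
      have h1 := hg e he
      have h2 := hg e' he'
      rw [hee', h2] at h1
      exact (Sum.inl.inj h1).symm)
    simpa using this
  · intro v
    rw [Finset.filter_map, Finset.card_map]
    have : ∀ e ∈ T.filter ((fun e : V × V => e.2 = v) ∘ (Function.Embedding.subtype _)),
        ∃ i, f (Sum.inr e) = Sum.inr (Sum.inl (v, i)) := by
      intro e he
      rw [Finset.mem_filter] at he
      obtain ⟨j, hj⟩ := hT e he.1
      have hev : e.1.2 = v := he.2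
      exact ⟨j, by rw [hj, hev]⟩
    choose! g hg using this
    have := Finset.card_le_card_of_injOn (t := (Finset.univ : Finset Bool)) g
      (fun _ _ => Finset.mem_coe.2 (Finset.mem_univ _)) (by
      intro e he e' he' hee'
      have h1 := hg e he
      have h2 := hg e' he'
      rw [hee', ← h2] at h1
      exact Sum.inr.inj (hf h1))
    simpa using this
  · rw [Finset.card_map]
    have hsub : (Finset.univ : Finset (V × Bool)).image (fun x => f (Sum.inl x)) ⊆
        T.image Sum.inl ∪ (Finset.univ : Finset (Fin d)).image (fun i => Sum.inr (Sum.inr i)) := by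
      intro b hb
      obtain ⟨x, -, rfl⟩ := Finset.mem_image.1 hb
      have h1 := hfr (Sum.inl x)
      rcases hfe : f (Sum.inl x) with e' | y | i
      · apply Finset.mem_union_left
        apply Finset.mem_image_of_mem
        simp only [T, Finset.mem_filter, Finset.mem_univ, true_and]
        exact ⟨x, hfe⟩
      · rw [hfe] at h1
        exact absurd h1 (by simp [r])
      · apply Finset.mem_union_right
        exact Finset.mem_image_of_mem (fun i => Sum.inr (Sum.inr i)) (Finset.mem_univ i)
    have h1 := (Finset.card_le_card hsub).trans (Finset.card_union_le _ _)
    have hinj : Function.Injective fun x : V × Bool => f (Sum.inl x) := hf.comp Sum.inl_injective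
    rw [Finset.card_image_of_injective _ hinj] at h1
    have h2 : (T.image (Sum.inl : E → E ⊕ ((V × Bool) ⊕ Fin d))).card ≤ T.card :=
      Finset.card_image_le
    have h3 : ((Finset.univ : Finset (Fin d)).image
      (fun i => (Sum.inr (Sum.inr i) : E ⊕ ((V × Bool) ⊕ Fin d)))).card ≤ d :=
      Finset.card_image_le.trans (by simp)
    simp at h1
    omega

end Flow

end SimpleGraph

/-! ### Rounding a flow to a two-matching -/

namespace SimpleGraph

section Rounding

/-- A closed walk of odd length contains an odd cycle that is not longer. -/
theorem exists_isCycleList_of_odd {V : Type*} (G : SimpleGraph V) (m : ℕ) (hm : Odd m)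
    (f : ℕ → V) (hf : ∀ i < m, G.Adj (f i) (f (i + 1))) (h0 : f m = f 0) :
    ∃ l, G.IsCycleList l ∧ l.length ≤ m ∧ ∀ v ∈ l, ∃ i < m, f i = v := by
  -- A repeated vertex splits the walk into two shorter closed walks, one of which is odd.
  induction m using Nat.strong_induction_on generalizing f with
  | _ m ih =>
    by_cases hinj : ∀ i < m, ∀ j < m, f i = f j → i = j
    · have hm1 : m ≠ 1 := by
        rintro rfl
        have := hf 0 (by omega)
        rw [zero_add, h0] at this
        exact G.irrefl this
      have hm3 : 3 ≤ m := by
        rcases hm with ⟨k, rfl⟩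
        omega
      refine ⟨(List.range m).map f, ⟨?_, by simpa using hm3, ?_, f 0, ?_, f (m - 1), ?_, ?_⟩,
        by simp, ?_⟩
      · refine List.Nodup.map_on ?_ List.nodup_range
        intro i hi j hj h
        exact hinj i (List.mem_range.1 hi) j (List.mem_range.1 hj) h
      · rw [List.isChain_iff_getElem]
        intro i hi
        simp only [List.getElem_map, List.getElem_range]
        apply hf
        simp at hi
        omega
      · simp only [List.head?_map, List.head?_range]
        rw [if_neg (by omega)]
        simp
      · simp only [List.getLast?_map, List.getLast?_range]
        rw [if_neg (by omega)]
        simp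
      · have := hf (m - 1) (by omega)
        rwa [Nat.sub_add_cancel (by omega), h0] at this
      · intro v hv
        obtain ⟨i, hi, rfl⟩ := List.mem_map.1 hv
        exact ⟨i, List.mem_range.1 hi, rfl⟩
    · have : ∃ i j, i < j ∧ j < m ∧ f i = f j := by
        push Not at hinj
        obtain ⟨i, hi, j, hj, h, hne⟩ := hinj
        rcases lt_or_gt_of_ne hne with hlt | hlt
        · exact ⟨i, j, hlt, hj, h⟩
        · exact ⟨j, i, hlt, hi, h.symm⟩
      obtain ⟨i, j, hij, hj, hfij⟩ := this
      rcases Nat.even_or_odd (j - i) with hev | hodd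
      · have hodd : Odd (m - (j - i)) := Nat.Odd.sub_even (by omega) hm hev
        obtain ⟨l, h1, h2, h3⟩ := ih (m - (j - i)) (by omega) hodd
          (fun k => if k ≤ i then f k else f (k + (j - i))) (by
            intro k hk
            by_cases h1 : k + 1 ≤ i
            · rw [if_pos (by omega), if_pos h1]
              exact hf k (by omega)
            · by_cases h2 : k = i
              · subst h2
                rw [if_pos le_rfl, if_neg (by omega), hfij,
                  show k + 1 + (j - k) = j + 1 by omega]
                exact hf j hj
              · rw [if_neg (by omega), if_neg (by omega),
                  show k + 1 + (j - i) = k + (j - i) + 1 by omega]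
                exact hf _ (by omega)) (by
            rw [if_neg (by omega), if_pos (by omega), Nat.sub_add_cancel (by omega), h0])
        refine ⟨l, h1, by omega, ?_⟩
        intro v hv
        obtain ⟨k, hk, hkv⟩ := h3 v hv
        by_cases h : k ≤ i
        · rw [if_pos h] at hkv
          exact ⟨k, by omega, hkv⟩
        · rw [if_neg h] at hkv
          exact ⟨_, by omega, hkv⟩
      · obtain ⟨l, h1, h2, h3⟩ := ih (j - i) (by omega) hodd (fun k => f (i + k))
          (fun k hk => hf (i + k) (by omega)) (by
            rw [Nat.add_sub_cancel' hij.le, add_zero, hfij])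
        refine ⟨l, h1, by omega, ?_⟩
        intro v hv
        obtain ⟨k, hk, hkv⟩ := h3 v hv
        exact ⟨_, by omega, hkv⟩

/-- Two sets of size at most two can be labelled by a single function to `Bool` that separates the
points of each of them. -/
theorem exists_injOn_bool {V : Type*} [DecidableEq V] (O I : Finset V) (hO : O.card ≤ 2)
    (hI : I.card ≤ 2) :
    ∃ f : V → Bool, Set.InjOn f O ∧ Set.InjOn f I := by
  have h1 : ∀ S : Finset V, S.card ≤ 2 → ∃ f : V → Bool, Set.InjOn f S := by
    intro S hS
    rcases Nat.lt_or_ge S.card 2 with h | h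
    · exact ⟨fun _ => true, fun a ha b hb _ => Finset.card_le_one.1 (by omega) a ha b hb⟩
    · obtain ⟨a, b, hab, rfl⟩ := Finset.card_eq_two.1 (le_antisymm hS h)
      refine ⟨fun x => decide (x = a), ?_⟩
      intro x hx y hy hxy
      simp only [Finset.coe_insert, Finset.coe_singleton, Set.mem_insert_iff,
        Set.mem_singleton_iff] at hx hy
      rcases hx with rfl | rfl <;> rcases hy with rfl | rfl <;> simp_all
  obtain ⟨f, hf⟩ := h1 O hO
  rcases Nat.lt_or_ge I.card 2 with h | h
  · exact ⟨f, hf, fun a ha b hb _ => Finset.card_le_one.1 (by omega) a ha b hb⟩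
  obtain ⟨c, d, hcd, rfl⟩ := Finset.card_eq_two.1 (le_antisymm hI h)
  have key : ∀ c d : V, c ≠ d → d ∉ O →
      ∃ f : V → Bool, Set.InjOn f O ∧ Set.InjOn f ({c, d} : Finset V) := by
    intro c d hcd hd
    refine ⟨Function.update f d (!f c), ?_, ?_⟩
    · intro x hx y hy hxy
      have hxd : x ≠ d := by rintro rfl; exact hd hx
      have hyd : y ≠ d := by rintro rfl; exact hd hy
      rw [Function.update_of_ne hxd, Function.update_of_ne hyd] at hxy
      exact hf hx hy hxy
    · intro x hx y hy hxy
      simp only [Finset.coe_insert, Finset.coe_singleton, Set.mem_insert_iff,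
        Set.mem_singleton_iff] at hx hy
      rcases hx with rfl | rfl <;> rcases hy with rfl | rfl <;> simp_all
  by_cases hd : d ∈ O
  · by_cases hc : c ∈ O
    · have : ({c, d} : Finset V) ⊆ O := by
        intro x hx
        simp only [Finset.mem_insert, Finset.mem_singleton] at hx
        rcases hx with rfl | rfl <;> assumption
      exact ⟨f, hf, hf.mono (Finset.coe_subset.2 this)⟩
    · rw [Finset.pair_comm]
      exact key d c hcd.symm hc
  · exact key c d hcd hd

open Classical in
/-- Rounding of a flow on the bipartite double cover. The arcs of `R` are distributed to two copies
of each vertex so that every copy has at most one incoming and one outgoing arc and opposite arcs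
are incident to the same copies. Every other edge along the resulting paths and cycles is kept;
only odd cycles lose, and these are either long or contain a short odd cycle of `G`. -/
theorem exists_two_matching {V : Type*} [Fintype V] (G : SimpleGraph V) (d L : ℕ) (Z : Finset V)
    (hZ : ∀ l, G.IsCycleList l → l.length ≤ L → ∃ v ∈ l, v ∈ Z)
    (R : Finset (V × V)) (hR : ∀ e ∈ R, G.Adj e.1 e.2)
    (hout : ∀ u, (R.filter fun e => e.1 = u).card ≤ 2)
    (hin : ∀ v, (R.filter fun e => e.2 = v).card ≤ 2) (hcard : 2 * Fintype.card V ≤ R.card + d) :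
    ∃ F : SimpleGraph V, F ≤ G ∧ (∀ v, F.degree v ≤ 2) ∧
      L * (∑ v, (2 - F.degree v)) ≤ L * d + 2 * Fintype.card V + 2 * L * Z.card := by
  have hlab : ∀ u, ∃ f : V → Bool, (∀ v w, (u, v) ∈ R → (u, w) ∈ R → f v = f w → v = w) ∧
      (∀ v w, (v, u) ∈ R → (w, u) ∈ R → f v = f w → v = w) := by
    intro u
    obtain ⟨f, h1, h2⟩ := exists_injOn_bool ((R.filter fun e => e.1 = u).image Prod.snd)
      ((R.filter fun e => e.2 = u).image Prod.fst) (Finset.card_image_le.trans (hout u))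
      (Finset.card_image_le.trans (hin u))
    refine ⟨f, fun v w hv hw => h1 ?_ ?_, fun v w hv hw => h2 ?_ ?_⟩ <;> simpa
  choose lab hlabO hlabI using hlab
  -- the arc from `u` to `v` joins the copy `lab u v` of `u` to the copy `lab v u` of `v`
  let A : V × Bool → V × Bool → Prop := fun x y =>
    (x.1, y.1) ∈ R ∧ x.2 = lab x.1 y.1 ∧ y.2 = lab y.1 x.1
  have hAout : ∀ {x y y'}, A x y → A x y' → y = y' := by
    rintro ⟨u, i⟩ ⟨v, j⟩ ⟨v', j'⟩ ⟨h1, h2, h3⟩ ⟨h1', h2', h3'⟩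
    simp only at *
    have := hlabO u v v' h1 h1' (h2 ▸ h2')
    subst this
    rw [h3, h3']
  have hAin : ∀ {x x' y}, A x y → A x' y → x = x' := by
    rintro ⟨u, i⟩ ⟨u', i'⟩ ⟨v, j⟩ ⟨h1, h2, h3⟩ ⟨h1', h2', h3'⟩
    simp only at *
    have := hlabI v u u' h1 h1' (h3 ▸ h3')
    subst this
    rw [h2, h2']
  have hAG : ∀ {x y}, A x y → G.Adj x.1 y.1 := fun h => hR _ h.1
  let Q : SimpleGraph (V × Bool) :=
    { Adj := fun x y => A x y ∨ A y x
      symm := ⟨fun x y h => h.symm⟩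
      loopless := ⟨fun x h => by rcases h with h | h <;> exact G.irrefl (hAG h)⟩ }
  have hQG : ∀ {x y}, Q.Adj x y → G.Adj x.1 y.1 := by
    intro x y h
    rcases h with h | h
    · exact hAG h
    · exact (hAG h).symm
  let out : V × Bool → ℕ := fun x => (Finset.univ.filter fun y => A x y).card
  let inn : V × Bool → ℕ := fun x => (Finset.univ.filter fun y => A y x).card
  have hout1 : ∀ x, out x ≤ 1 := fun x => Finset.card_le_one.2 (by
    intro a ha b hb
    exact hAout (Finset.mem_filter.1 ha).2 (Finset.mem_filter.1 hb).2)
  have hinn1 : ∀ x, inn x ≤ 1 := fun x => Finset.card_le_one.2 (by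
    intro a ha b hb
    exact hAin (Finset.mem_filter.1 ha).2 (Finset.mem_filter.1 hb).2)
  have hnbr : ∀ x, Q.neighborFinset x =
      (Finset.univ.filter fun y => A x y) ∪ (Finset.univ.filter fun y => A y x) := by
    intro x
    ext y
    simp [Q]
  have hdeg : ∀ x, Q.degree x ≤ 2 := by
    intro x
    rw [← card_neighborFinset_eq_degree, hnbr]
    have := hout1 x
    have := hinn1 x
    exact (Finset.card_union_le _ _).trans (by simp only [out, inn] at *; omega)
  have hdef : ∑ x, (2 - out x - inn x) ≤ 2 * d := by
    have h1 : ∑ x, out x = R.card := by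
      simp only [out]
      rw [← Finset.card_sigma]
      refine Finset.card_bij' (fun e _ => (e.1.1, e.2.1))
        (fun e _ => ⟨(e.1, lab e.1 e.2), (e.2, lab e.2 e.1)⟩) ?_ ?_ ?_ ?_
      · rintro ⟨⟨u, i⟩, v, j⟩ h
        simp at h
        exact h.1
      · rintro ⟨u, v⟩ h
        simp [A, h]
      · rintro ⟨⟨u, i⟩, v, j⟩ h
        simp at h
        obtain ⟨-, h2, h3⟩ := h
        simp only at h2 h3
        simp [h2, h3]
      · rintro ⟨u, v⟩ h
        rfl
    have h2 : ∑ x, inn x = ∑ x, out x := by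
      simp only [out, inn, Finset.card_filter]
      rw [Finset.sum_comm]
    have h3 : ∑ x, (2 - out x - inn x) + (∑ x, out x + ∑ x, inn x) = ∑ x : V × Bool, 2 := by
      rw [← Finset.sum_add_distrib, ← Finset.sum_add_distrib]
      refine Finset.sum_congr rfl fun x _ => ?_
      have := hout1 x
      have := hinn1 x
      omega
    simp at h3
    omega
  obtain ⟨ls, hnd, hmem, hls⟩ := exists_component_lists Q hdeg
  -- Only odd components leave a copy unmatched; their number is bounded by the missing arcs, the
  -- long cycles and the cycles that contain a short odd cycle of `G`.
  have hodd : ∀ l ∈ ls, 2 * L * (l.length % 2) ≤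
      (l.map fun x => L * (2 - out x - inn x) + 2 * (1 + L * if x.1 ∈ Z then 1 else 0)).sum := by
    intro l hl
    obtain ⟨hne, hlnd, hch, hcl, hcase⟩ := hls l hl
    rcases Nat.mod_two_eq_zero_or_one l.length with h0 | h1
    · rw [h0]; omega
    rw [h1, mul_one, List.sum_map_add, List.sum_map_mul_left, List.sum_map_mul_left,
      List.sum_map_add, List.sum_map_mul_left]
    rcases hcase with hcase | hcyc
    · have hle : (l.map fun v => 2 - Q.degree v).sum ≤ (l.map fun x => 2 - out x - inn x).sum := by
        apply List.sum_le_sum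
        intro x hx
        suffices h : out x + inn x ≤ Q.degree x by omega
        rw [← card_neighborFinset_eq_degree, hnbr, Finset.card_union_of_disjoint]
        -- two opposite arcs form a component with two vertices
        rw [Finset.disjoint_left]
        intro y hy hy'
        have hxy : A x y := (Finset.mem_filter.1 hy).2
        have hyx : A y x := (Finset.mem_filter.1 hy').2
        have hx' : ∀ z, Q.Adj x z → z = y := by
          rintro z (h | h)
          · exact hAout h hxy
          · exact hAin h hyx
        have hy' : ∀ z, Q.Adj y z → z = x := by
          rintro z (h | h)
          · exact hAout h hyx
          · exact hAin h hxy
        have hyl : y ∈ l := hcl x hx y (Or.inl hxy)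
        have hlen1 : l.length ≠ 1 := by
          intro h
          obtain ⟨a, rfl⟩ := List.length_eq_one_iff.1 h
          simp at hx hyl
          rw [hx, hyl] at hxy
          exact G.irrefl (hAG hxy)
        have hlen3 : 3 ≤ l.length := by
          have : 0 < l.length := List.length_pos_iff.2 hne
          omega
        have hadj : ∀ i (hi : i + 1 < l.length), Q.Adj l[i] l[i + 1] := fun i hi =>
          List.isChain_iff_getElem.1 hch i hi
        have hmid : ∀ i (hi : i + 2 < l.length), l[i] ≠ l[i + 2] := by
          intro i hi h
          have := (hlnd.getElem_inj_iff).1 h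
          omega
        obtain ⟨i, hi, rfl⟩ := List.getElem_of_mem hx
        obtain ⟨j, hj, rfl⟩ := List.getElem_of_mem hyl
        have hstep : ∀ k (hk : k < l.length) z, (∀ w, Q.Adj l[k] w → w = z) →
            k = 0 ∨ k + 1 = l.length := by
          intro k hk z hz
          by_contra! hcon
          have h1 := hz _ (hadj k (by omega))
          have h2 := hz l[k - 1] (by
            have := hadj (k - 1) (by omega)
            simp only [Nat.sub_add_cancel (Nat.pos_of_ne_zero hcon.1)] at this
            exact this.symm)
          have := (hlnd.getElem_inj_iff).1 (h1.trans h2.symm)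
          omega
        have hij : i ≠ j := by
          rintro rfl
          exact G.irrefl (hAG hxy)
        have h1 := hstep i hi _ hx'
        have h2 := hstep j hj _ hy'
        rcases h1 with rfl | h1
        · have := (hlnd.getElem_inj_iff).1 (hx' _ (hadj 0 (by omega)))
          omega
        · have hj0 : j = 0 := by omega
          subst hj0
          have := (hlnd.getElem_inj_iff).1 (hy' _ (hadj 0 (by omega)))
          omega
      have := Nat.mul_le_mul_left L (hcase.trans hle)
      omega
    · have : L ≤ l.length ∨ 1 ≤ (l.map fun x => if x.1 ∈ Z then 1 else 0).sum := by
        by_cases hl' : l.length ≤ L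
        · right
          obtain ⟨-, h3, -, a, ha, b, hb, hba⟩ := hcyc
          have hpos : 0 < l.length := by omega
          obtain ⟨c, hc, hcl, hcv⟩ := exists_isCycleList_of_odd G l.length (Nat.odd_iff.2 h1)
            (fun i => (l[i % l.length]'(Nat.mod_lt _ hpos)).1) (by
              intro i hi
              by_cases hi1 : i + 1 < l.length
              · simp only [Nat.mod_eq_of_lt hi, Nat.mod_eq_of_lt hi1]
                exact hQG (List.isChain_iff_getElem.1 hch i hi1)
              · have hil : i + 1 = l.length := by omega
                simp only [Nat.mod_eq_of_lt hi, hil, Nat.mod_self]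
                rw [List.head?_eq_getElem?, List.getElem?_eq_getElem hpos] at ha
                rw [List.getLast?_eq_getElem?, List.getElem?_eq_getElem (by omega)] at hb
                simp only [Option.mem_def, Option.some.injEq] at ha hb
                have := hQG hba
                rw [← ha, ← hb] at this
                have hi' : i = l.length - 1 := by omega
                subst hi'
                exact this) (by simp)
          obtain ⟨v, hv, hvZ⟩ := hZ c hc (hcl.trans hl')
          obtain ⟨i, hi, hiv⟩ := hcv v hv
          have hvl : l[i % l.length]'(Nat.mod_lt _ hpos) ∈ l := List.getElem_mem _
          have := List.single_le_sum (l := l.map fun x => if x.1 ∈ Z then 1 else 0) (by simp) 1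
            (List.mem_map.2 ⟨_, hvl, by rw [if_pos]; rw [hiv]; exact hvZ⟩)
          exact this
        · left; omega
      simp only [List.map_const', List.sum_replicate, smul_eq_mul, mul_one]
      rcases this with h | h
      · have := Nat.zero_le (L * (l.map fun x => 2 - out x - inn x).sum)
        have := Nat.zero_le (L * (l.map fun x => if x.1 ∈ Z then 1 else 0).sum)
        omega
      · have := Nat.mul_le_mul_left L h
        have := Nat.zero_le (L * (l.map fun x => 2 - out x - inn x).sum)
        omega
  have hsum := sum_map_le_sum_of_flatten hnd _ _ hodd
  -- two copies are matched if they are at positions `2 * k` and `2 * k + 1` of the same component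
  let M : V × Bool → V × Bool → Prop := fun x y =>
    ∃ l ∈ ls, ∃ i j, ∃ (hi : i < l.length) (hj : j < l.length),
      l[i] = x ∧ l[j] = y ∧ i / 2 = j / 2 ∧ i ≠ j
  have hMsymm : ∀ {x y}, M x y → M y x := by
    rintro x y ⟨l, hl, i, j, hi, hj, h1, h2, h3, h4⟩
    exact ⟨l, hl, j, i, hj, hi, h2, h1, h3.symm, h4.symm⟩
  have hMQ : ∀ {x y}, M x y → Q.Adj x y := by
    rintro x y ⟨l, hl, i, j, hi, hj, rfl, rfl, h3, h4⟩
    have hch := (hls l hl).2.2.1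
    have : j = i + 1 ∨ i = j + 1 := by omega
    rcases this with rfl | rfl
    · exact List.isChain_iff_getElem.1 hch i hj
    · exact (List.isChain_iff_getElem.1 hch j hi).symm
  have huniq : ∀ {x} {l l' : List (V × Bool)}, l ∈ ls → l' ∈ ls → x ∈ l → x ∈ l' → l = l' := by
    intro x l l' hl hl' hx hx'
    by_contra hne
    have hd : List.Pairwise List.Disjoint ls := (List.nodup_flatten.1 hnd).2
    have : Std.Symm (List.Disjoint (α := V × Bool)) := ⟨fun _ _ h => List.disjoint_symm h⟩
    exact hd.forall hl hl' hne hx hx'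
  have hMuniq : ∀ {x y y'}, M x y → M x y' → y = y' := by
    rintro x y y' ⟨l, hl, i, j, hi, hj, rfl, rfl, h3, h4⟩
      ⟨l', hl', i', j', hi', hj', h1, rfl, h5, h6⟩
    have hll : l' = l := huniq hl' hl (h1 ▸ List.getElem_mem hi') (List.getElem_mem hi)
    subst hll
    have hii := ((hls _ hl).2.1.getElem_inj_iff).1 h1
    have : j = j' := by omega
    subst this
    rfl
  let W : Finset (V × Bool) := Finset.univ.filter fun x => ¬ ∃ y, M x y
  have hW : 2 * L * W.card ≤ 2 * L * (ls.map fun l => l.length % 2).sum := by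
    apply Nat.mul_le_mul_left
    have h1 : W.card = ((ls.map fun l => (l.map fun x => if x ∈ W then 1 else 0).sum)).sum := by
      have h2 : (ls.map fun l => (l.map fun x => if x ∈ W then 1 else 0).sum).sum =
          (ls.flatten.map fun x => if x ∈ W then 1 else 0).sum := by
        rw [List.map_flatten, List.sum_flatten, List.map_map]
        rfl
      rw [h2, ← List.sum_toFinset _ hnd]
      have : ls.flatten.toFinset = Finset.univ := by
        rw [Finset.eq_univ_iff_forall]
        intro x
        rw [List.mem_toFinset]
        exact hmem x
      rw [this]
      simp
    rw [h1]
    apply List.sum_le_sum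
    intro l hl
    obtain ⟨hne, hlnd, -⟩ := hls l hl
    rw [← List.sum_toFinset _ hlnd, ← Finset.card_filter]
    have hWl : ∀ i (hi : i < l.length), l[i] ∈ W → i + 1 = l.length ∧ i % 2 = 0 := by
      intro i hi hiW
      have hno : ¬ ∃ y, M l[i] y := (Finset.mem_filter.1 hiW).2
      by_contra hcon
      apply hno
      rcases Nat.mod_two_eq_zero_or_one i with h | h
      · exact ⟨l[i + 1]'(by omega), l, hl, i, i + 1, hi, by omega, rfl, rfl, by omega, by omega⟩
      · exact ⟨l[i - 1], l, hl, i, i - 1, hi, by omega, rfl, rfl, by omega, by omega⟩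
    rcases Nat.mod_two_eq_zero_or_one l.length with h | h
    · rw [h, Nat.le_zero, Finset.card_eq_zero, Finset.filter_eq_empty_iff]
      intro x hx hxW
      obtain ⟨i, hi, rfl⟩ := List.getElem_of_mem (List.mem_toFinset.1 hx)
      have := hWl i hi hxW
      omega
    · rw [h]
      apply Finset.card_le_one.2
      intro x hx y hy
      rw [Finset.mem_filter] at hx hy
      obtain ⟨i, hi, rfl⟩ := List.getElem_of_mem (List.mem_toFinset.1 hx.1)
      obtain ⟨j, hj, rfl⟩ := List.getElem_of_mem (List.mem_toFinset.1 hy.1)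
      have h1 := hWl i hi hx.2
      have h2 := hWl j hj hy.2
      have : i = j := by omega
      subst this
      rfl
  obtain ⟨F, hF⟩ : ∃ F : SimpleGraph V, ∀ u v, F.Adj u v ↔ ∃ i j, M (u, i) (v, j) :=
    ⟨{ Adj := fun u v => ∃ i j, M (u, i) (v, j)
       symm := ⟨fun u v ⟨i, j, h⟩ => ⟨j, i, hMsymm h⟩⟩
       loopless := ⟨fun u ⟨i, j, h⟩ => by
        have h' := hQG (hMQ h)
        exact G.irrefl h'⟩ }, fun _ _ => Iff.rfl⟩
  -- an edge of `G` is the image of at most one matched pair of copies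
  have hproj : ∀ {u v i j i' j'}, M (u, i) (v, j) → M (u, i') (v, j') → i = i' := by
    intro u v i j i' j' h h'
    rcases hMQ h with ⟨h1, h2, h3⟩ | ⟨h1, h2, h3⟩ <;>
    rcases hMQ h' with ⟨h1', h2', h3'⟩ | ⟨h1', h2', h3'⟩ <;> simp only at * <;> simp [*]
  have hFdeg : ∀ v, F.degree v =
      (Finset.univ.filter fun i : Bool => ∃ y, M (v, i) y).card := by
    intro v
    rw [← card_neighborFinset_eq_degree]
    have h1 : ∀ w ∈ F.neighborFinset v, ∃ i, ∃ j, M (v, i) (w, j) := by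
      intro w hw
      exact (hF _ _).1 ((mem_neighborFinset _ _ _).1 hw)
    choose! g hg using h1
    refine Finset.card_bij (fun w _ => g w) ?_ ?_ ?_
    · intro w hw
      obtain ⟨j, hj⟩ := hg w hw
      exact Finset.mem_filter.2 ⟨Finset.mem_univ _, _, hj⟩
    · intro w hw w' hw' h
      obtain ⟨j, hj⟩ := hg w hw
      obtain ⟨j', hj'⟩ := hg w' hw'
      rw [h] at hj
      exact congrArg Prod.fst (hMuniq hj hj')
    · intro i hi
      obtain ⟨-, ⟨w, j⟩, hw⟩ := Finset.mem_filter.1 hi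
      have hwF : w ∈ F.neighborFinset v := by
        rw [mem_neighborFinset, hF]
        exact ⟨i, j, hw⟩
      obtain ⟨j', hj'⟩ := hg w hwF
      exact ⟨w, hwF, hproj hj' hw⟩
  refine ⟨F, ?_, ?_, ?_⟩
  · intro u v huv
    obtain ⟨i, j, h⟩ := (hF u v).1 huv
    exact hQG (hMQ h)
  · intro v
    rw [hFdeg]
    exact (Finset.card_le_univ _).trans (by simp)
  · have h1 : ∑ v, (2 - F.degree v) = W.card := by
      simp only [W]
      rw [Finset.card_filter, Fintype.sum_prod_type]
      refine Finset.sum_congr rfl fun v _ => ?_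
      rw [hFdeg, ← Finset.card_filter]
      have := Finset.card_filter_add_card_filter_not (s := (Finset.univ : Finset Bool))
        (fun i => ∃ y, M (v, i) y)
      simp only [Finset.card_univ, Fintype.card_bool] at this
      omega
    have h2 : (ls.map fun l => 2 * L * (l.length % 2)).sum =
        2 * L * (ls.map fun l => l.length % 2).sum := List.sum_map_mul_left ..
    have h3 : ∑ x : V × Bool, (if x.1 ∈ Z then 1 else 0) = 2 * Z.card := by
      rw [Fintype.sum_prod_type_right, Fintype.sum_bool]
      simp [two_mul]
    rw [h2, Finset.sum_add_distrib, ← Finset.mul_sum, ← Finset.mul_sum, Finset.sum_add_distrib,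
      ← Finset.mul_sum, h3] at hsum
    simp only [Finset.sum_const, Finset.card_univ, Fintype.card_prod, Fintype.card_bool,
      smul_eq_mul, mul_one] at hsum
    have h4 := Nat.mul_le_mul_left L hdef
    rw [h1]
    linarith

end Rounding

end SimpleGraph

/-! ### Path covers, Hamiltonian completions and cuts -/

namespace SimpleGraph

section Covers

variable {V : Type*}

/-- Disjoint lists covering all vertices, each tracing a path, form a path cover. -/
theorem hasPathCover_of_lists (G : SimpleGraph V) (ls : List (List V)) (hnd : ls.flatten.Nodup)
    (hmem : ∀ v, v ∈ ls.flatten) (h : ∀ l ∈ ls, l ≠ [] ∧ l.IsChain G.Adj) :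
    G.HasPathCover ls.length := by
  have hget : ∀ i : Fin ls.length, ls.get i ∈ ls := fun i => List.get_mem ls i
  refine ⟨fun i => (ls.get i).head (h _ (hget i)).1, fun i => (ls.get i).getLast (h _ (hget i)).1,
    fun i => Walk.ofSupport (ls.get i) (h _ (hget i)).1 (h _ (hget i)).2, ?_, ?_⟩
  · intro i
    apply Walk.IsPath.mk'
    rw [Walk.support_ofSupport]
    exact (List.nodup_flatten.1 hnd).1 _ (hget i)
  · intro v
    simp only [Walk.support_ofSupport]
    obtain ⟨l, hl, hvl⟩ := List.mem_flatten.1 (hmem v)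
    obtain ⟨i, rfl⟩ := List.mem_iff_get.1 hl
    refine ⟨i, hvl, ?_⟩
    intro j hj
    by_contra hne
    have hd := List.pairwise_iff_get.1 (List.nodup_flatten.1 hnd).2
    rcases lt_or_gt_of_ne hne with hlt | hlt
    · exact hd j i hlt hj hvl
    · exact hd i j hlt hvl hj

theorem isHamiltonian_of_list [DecidableEq V] [Fintype V] (G : SimpleGraph V) (l : List V)
    (hnd : l.Nodup) (hmem : ∀ v, v ∈ l) (hch : l.IsChain G.Adj) (hne : l ≠ []) (h3 : 3 ≤ l.length)
    (hclose : G.Adj (l.getLast hne) (l.head hne)) : G.IsHamiltonian := by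
  intro _
  set p := Walk.ofSupport l hne hch with hp
  have hsupp : p.support = l := Walk.support_ofSupport hne hch
  have hlen : p.length = l.length - 1 := Walk.length_ofSupport hne hch
  have hpath : p.IsPath := Walk.IsPath.mk' (by rw [hsupp]; exact hnd)
  refine ⟨_, Walk.cons hclose p, ?_⟩
  rw [Walk.isHamiltonianCycle_iff_isCycle_and_length_eq]
  constructor
  · rw [Walk.cons_isCycle_iff]
    refine ⟨hpath, fun he => ?_⟩
    rw [Sym2.eq_swap] at he
    have := hpath.length_eq_one_of_mem_edges he
    omega
  · have hcard : l.length = Fintype.card V := by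
      rw [← List.toFinset_card_of_nodup hnd, ← Finset.card_univ]
      congr 1
      rw [Finset.eq_univ_iff_forall]
      intro v
      exact List.mem_toFinset.2 (hmem v)
    rw [Walk.length_cons, hlen, ← hcard]
    omega

theorem ncard_edgeSet_sup_edge_le (H : SimpleGraph V) (a b : V) :
    (H ⊔ edge a b).edgeSet.ncard ≤ H.edgeSet.ncard + 1 := by
  rw [edgeSet_sup]
  refine (Set.ncard_union_le _ _).trans ?_
  have := Set.ncard_le_ncard (edgeSet_edge_subset (v := a) (w := b)) (Set.finite_singleton _)
  rw [Set.ncard_singleton] at this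
  omega

/-- Consecutive paths are joined end to end with one additional edge for each junction. -/
theorem exists_isChain_flatten (G : SimpleGraph V) (l : List V) (ls : List (List V))
    (hnd : (l :: ls).flatten.Nodup) (h : ∀ l' ∈ l :: ls, l' ≠ [] ∧ l'.IsChain G.Adj) :
    ∃ H : SimpleGraph V, H.edgeSet.ncard ≤ ls.length ∧
      (l :: ls).flatten.IsChain (G ⊔ H).Adj := by
  induction ls generalizing l with
  | nil =>
    refine ⟨⊥, by simp, ?_⟩
    simpa using (h l (by simp)).2
  | cons l' ls ih =>
    rw [List.flatten_cons, List.nodup_append] at hnd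
    obtain ⟨hl, hrest, hdisj⟩ := hnd
    obtain ⟨H, hH, hch⟩ := ih l' hrest (fun l'' hl'' => h l'' (List.mem_cons_of_mem _ hl''))
    have hne : l ≠ [] := (h l (by simp)).1
    have hne' : (l' :: ls).flatten ≠ [] := by
      have := (h l' (by simp)).1
      simp [this]
    refine ⟨H ⊔ edge (l.getLast hne) ((l' :: ls).flatten.head hne'), ?_, ?_⟩
    · have := ncard_edgeSet_sup_edge_le H (l.getLast hne) ((l' :: ls).flatten.head hne')
      rw [List.length_cons]
      omega
    · refine List.isChain_append.2 ?_
      refine ⟨?_, ?_, ?_⟩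
      · exact (h l (by simp)).2.imp fun a b hab => Or.inl hab
      · refine hch.imp fun a b hab => ?_
        rcases hab with hab | hab
        · exact Or.inl hab
        · exact Or.inr (Or.inl hab)
      · intro x hx y hy
        rw [List.getLast?_eq_some_getLast hne] at hx
        rw [List.head?_eq_some_head hne'] at hy
        simp only [Option.mem_def, Option.some.injEq] at hx hy
        subst hx; subst hy
        refine Or.inr (Or.inr ?_)
        rw [edge_adj]
        exact ⟨Or.inl ⟨rfl, rfl⟩, hdisj _ (List.getLast_mem hne) _ (List.head_mem hne')⟩

/-- The vertex-disjoint paths of a cover can be joined to a Hamiltonian cycle by adding as many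
edges as there are paths. -/
theorem exists_isHamiltonian_sup [DecidableEq V] [Fintype V] (G : SimpleGraph V)
    (ls : List (List V)) (hnd : ls.flatten.Nodup) (hmem : ∀ v, v ∈ ls.flatten)
    (h : ∀ l ∈ ls, l ≠ [] ∧ l.IsChain G.Adj) (h3 : 3 ≤ Fintype.card V) :
    ∃ H : SimpleGraph V, (G ⊔ H).IsHamiltonian ∧ H.edgeSet.ncard ≤ ls.length := by
  have hcard : ls.flatten.length = Fintype.card V := by
    rw [← List.toFinset_card_of_nodup hnd, ← Finset.card_univ]
    congr 1
    rw [Finset.eq_univ_iff_forall]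
    intro v
    exact List.mem_toFinset.2 (hmem v)
  cases ls with
  | nil => simp at hcard; omega
  | cons l ls =>
    obtain ⟨H, hH, hch⟩ := exists_isChain_flatten G l ls hnd h
    have hne : (l :: ls).flatten ≠ [] := List.ne_nil_of_length_pos (by omega)
    refine ⟨H ⊔ edge ((l :: ls).flatten.getLast hne) ((l :: ls).flatten.head hne), ?_, ?_⟩
    · refine isHamiltonian_of_list _ _ hnd hmem ?_ hne (by omega) ?_
      · refine hch.imp fun a b hab => ?_
        rcases hab with hab | hab
        · exact Or.inl hab
        · exact Or.inr (Or.inl hab)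
      · refine Or.inr (Or.inr ?_)
        rw [edge_adj]
        refine ⟨Or.inl ⟨rfl, rfl⟩, ?_⟩
        rw [List.head_eq_getElem, List.getLast_eq_getElem]
        intro heq
        have := (hnd.getElem_inj_iff).1 heq
        omega
    · have := ncard_edgeSet_sup_edge_le H ((l :: ls).flatten.getLast hne)
        ((l :: ls).flatten.head hne)
      rw [List.length_cons]
      omega

theorem pathCoverNumber_le [Fintype V] {G : SimpleGraph V} {k : ℕ} (h : G.HasPathCover k) :
    G.pathCoverNumber ≤ k := by
  classical
  unfold pathCoverNumber
  split_ifs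
  · exact Nat.zero_le _
  · exact Nat.sInf_le h

open Classical in
/-- Every vertex of degree one is an endpoint of its path. -/
theorem HasPathCover.card_degree_eq_one_le [Fintype V] {G : SimpleGraph V} {k : ℕ}
    (h : G.HasPathCover k) :
    (Finset.univ.filter fun v => G.degree v = 1).card ≤ 2 * k := by
  obtain ⟨s, t, p, hp, hcov⟩ := h
  have hsub : (Finset.univ.filter fun v => G.degree v = 1) ⊆
      (Finset.univ : Finset (Fin k)).image s ∪ (Finset.univ : Finset (Fin k)).image t := by
    intro v hv
    have hv1 : G.degree v = 1 := (Finset.mem_filter.1 hv).2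
    obtain ⟨i, hi, -⟩ := hcov v
    obtain ⟨j, hj, hjl⟩ := Walk.mem_support_iff_exists_getVert.1 hi
    by_cases h0 : j = 0
    · subst h0
      rw [Walk.getVert_zero] at hj
      exact Finset.mem_union_left _ (Finset.mem_image.2 ⟨i, Finset.mem_univ _, hj⟩)
    by_cases h1 : j = (p i).length
    · subst h1
      rw [Walk.getVert_length] at hj
      exact Finset.mem_union_right _ (Finset.mem_image.2 ⟨i, Finset.mem_univ _, hj⟩)
    have h2 := (hp i).ncard_neighborSet_toSubgraph_internal_eq_two h0 (by omega)
    rw [hj] at h2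
    have h3 := Set.ncard_le_ncard ((p i).toSubgraph.neighborSet_subset v) (Set.toFinite _)
    rw [h2, Set.ncard_eq_toFinset_card', Set.toFinset_card, card_neighborSet_eq_degree] at h3
    omega
  refine (Finset.card_le_card hsub).trans ((Finset.card_union_le _ _).trans ?_)
  have h1 := Finset.card_image_le (s := (Finset.univ : Finset (Fin k))) (f := s)
  have h2 := Finset.card_image_le (s := (Finset.univ : Finset (Fin k))) (f := t)
  simp only [Finset.card_univ, Fintype.card_fin] at h1 h2
  omega

open Classical in
/-- Every vertex of degree one is incident to an edge that is missing for Hamiltonicity. -/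
theorem card_degree_eq_one_le_of_isHamiltonian [Fintype V] {G H : SimpleGraph V}
    (h : (G ⊔ H).IsHamiltonian) (h3 : 3 ≤ Fintype.card V) :
    (Finset.univ.filter fun v => G.degree v = 1).card ≤ 2 * H.edgeSet.ncard := by
  obtain ⟨a, p, hp⟩ := h (by omega)
  have hdeg : ∀ v, G.degree v = 1 → 1 ≤ H.degree v := by
    intro v hv
    by_contra hcon
    have hH : ∀ w, ¬ H.Adj v w := by
      intro w hw
      have : 0 < H.degree v := (H.degree_pos_iff_exists_adj v).2 ⟨w, hw⟩
      omega
    have h2 := hp.isCycle.ncard_neighborSet_toSubgraph_eq_two (hp.mem_support v)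
    have h3 : p.toSubgraph.neighborSet v ⊆ G.neighborSet v := by
      intro w hw
      rcases p.toSubgraph.neighborSet_subset v hw with h | h
      · exact h
      · exact absurd h (hH w)
    have h4 := Set.ncard_le_ncard h3 (Set.toFinite _)
    rw [h2, Set.ncard_eq_toFinset_card', Set.toFinset_card, card_neighborSet_eq_degree] at h4
    omega
  have h1 := H.sum_degrees_eq_twice_card_edges
  rw [Set.ncard_eq_toFinset_card', ← edgeFinset, ← h1, Finset.card_filter]
  refine Finset.sum_le_sum fun v _ => ?_
  split_ifs with hv
  · exact hdeg v hv
  · exact Nat.zero_le _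

open Classical in
theorem card_degree_eq_one_le_pathCoverNumber [Fintype V] (G : SimpleGraph V)
    (h3 : 3 ≤ Fintype.card V) :
    (Finset.univ.filter fun v => G.degree v = 1).card ≤ 2 * G.pathCoverNumber := by
  unfold pathCoverNumber
  split_ifs with h
  · have h' : (G ⊔ ⊥).IsHamiltonian := by
      rw [sup_bot_eq]
      convert h
    have := card_degree_eq_one_le_of_isHamiltonian h' h3
    simpa using this
  · exact HasPathCover.card_degree_eq_one_le
      (Nat.sInf_mem (s := {k | G.HasPathCover k}) ⟨_, G.hasPathCover_card⟩)

open Classical in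
/-- The cut condition for flows on the bipartite double cover yields a path cover with few paths,
up to the loss on long cycles and on the vertices `Z` of short cycles. -/
theorem exists_cover_of_cut [Fintype V] (G : SimpleGraph V) (d L : ℕ) (Z : Finset V)
    (hZ : ∀ l, G.IsCycleList l → l.length ≤ L → ∃ v ∈ l, v ∈ Z)
    (h : ∀ A B : Finset V, 2 * A.card ≤ (G.interedges A Bᶜ).card + 2 * B.card + d)
    (h3 : 3 ≤ Fintype.card V) :
    ∃ k, G.HasPathCover k ∧ (∃ H : SimpleGraph V, (G ⊔ H).IsHamiltonian ∧ H.edgeSet.ncard ≤ k) ∧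
      2 * L * k ≤ L * d + 4 * Fintype.card V + 4 * L * Z.card := by
  obtain ⟨R, hR, hout, hin, hcard⟩ := exists_flow G d h
  obtain ⟨F, hFG, hF, hFsum⟩ := exists_two_matching G d L Z hZ R hR hout hin hcard
  obtain ⟨ls, hnd, hmem, hls, hlen⟩ := exists_path_lists F hF L Z (fun l hl hlL =>
    hZ l ⟨hl.1, hl.2.1, hl.2.2.1.imp fun a b hab => hFG hab, by
      obtain ⟨-, -, -, a, ha, b, hb, hab⟩ := hl
      exact ⟨a, ha, b, hb, hFG hab⟩⟩ hlL)
  have hls' : ∀ l ∈ ls, l ≠ [] ∧ l.IsChain G.Adj := fun l hl =>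
    ⟨(hls l hl).1, (hls l hl).2.imp fun a b hab => hFG hab⟩
  exact ⟨ls.length, hasPathCover_of_lists G ls hnd hmem hls',
    exists_isHamiltonian_sup G ls hnd hmem hls' h3, by linarith⟩

end Covers

end SimpleGraph

/-! ### The cut condition in locally sparse graphs -/

namespace SimpleGraph

section Cut

open Classical in
/-- The vertices of degree at most `k`. -/
noncomputable def lowDegree {V : Type*} [Fintype V] (G : SimpleGraph V) (k : ℕ) : Finset V :=
  Finset.univ.filter fun v => G.degree v ≤ k

open Classical in
/-- The number of neighbours of degree at most `k` in excess of one, summed over all vertices. -/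
noncomputable def lowExcess {V : Type*} [Fintype V] (G : SimpleGraph V) (k : ℕ) : ℕ :=
  ∑ b, ((G.neighborFinset b ∩ G.lowDegree k).card - 1)

open Classical in
/-- The number of incident edges that are missing, over all vertices, for a minimum degree of
two. -/
noncomputable def defect {V : Type*} [Fintype V] (G : SimpleGraph V) : ℕ :=
  ∑ v, (2 - G.degree v)

variable {V : Type*} [Fintype V] [DecidableEq V] (G : SimpleGraph V) [DecidableRel G.Adj]

omit [Fintype V] [DecidableEq V] in
theorem card_interedges_eq_sum (A C : Finset V) :
    (G.interedges A C).card = ∑ v ∈ A, (C.filter fun w => G.Adj v w).card := by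
  rw [interedges_def, Finset.card_filter, Finset.sum_product]
  simp only [Finset.card_filter]

omit [Fintype V] in
/-- If `G` is locally sparse, few vertices have `k` neighbours in a small set `B`: otherwise the
union of `B` with slightly more than `|B| / 2` of them would be too dense. -/
theorem card_high_degree_le {k m r : ℕ} (hk : 6 * r ≤ k) (hk0 : 0 < k)
    (hsparse : ∀ U : Finset V, U.Nonempty → U.card ≤ 2 * m →
      (G.interedges U U).card < 2 * r * U.card)
    (B : Finset V) (hB : B.card ≤ m) (Y : Finset V)
    (hY : ∀ v ∈ Y, k ≤ (B.filter fun w => G.Adj v w).card) : 2 * Y.card ≤ B.card := by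
  by_contra! hcon
  rcases B.eq_empty_or_nonempty with rfl | hBne
  · simp only [Finset.card_empty] at hcon
    obtain ⟨y, hy⟩ := Finset.card_pos.1 (by omega : 0 < Y.card)
    have := hY y hy
    simp at this
    omega
  have hBpos := hBne.card_pos
  obtain ⟨Y', hY'Y, hY'⟩ := Finset.exists_subset_card_eq (s := Y) (n := B.card / 2 + 1) (by omega)
  have hU := Finset.card_union_le Y' B
  have hUne : (Y' ∪ B).Nonempty := hBne.mono Finset.subset_union_right
  have h1 := hsparse (Y' ∪ B) hUne (by omega)
  have h2 : (G.interedges Y' B).card ≤ (G.interedges (Y' ∪ B) (Y' ∪ B)).card :=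
    Finset.card_le_card (interedges_mono G Finset.subset_union_left Finset.subset_union_right)
  have h3 : Y'.card * k ≤ (G.interedges Y' B).card := by
    rw [card_interedges_eq_sum, ← smul_eq_mul]
    exact Finset.card_nsmul_le_sum _ _ _ fun v hv => hY v (hY'Y hv)
  have h4 : (Y' ∪ B).card ≤ 3 * Y'.card := by omega
  have h5 : 2 * r * (Y' ∪ B).card ≤ 2 * r * (3 * Y'.card) := Nat.mul_le_mul_left _ h4
  have h6 : (6 * r) * Y'.card ≤ k * Y'.card := Nat.mul_le_mul_right _ hk
  nlinarith

/-- The cut condition for small `B`. A vertex of `A` with at most one neighbour outside `B` has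
degree at most one, or low degree and then a neighbour in `B`, or at least `k` neighbours in `B`.
The second kind is counted by the low-degree neighbours of `B`, at most one for each vertex of `B`
up to `lowExcess k`; the third kind consists of at most `|B| / 2` vertices. -/
theorem cut_le_of_card_le {k m r : ℕ} (hk : 6 * r ≤ k) (hk0 : 0 < k)
    (hsparse : ∀ U : Finset V, U.Nonempty → U.card ≤ 2 * m →
      (G.interedges U U).card < 2 * r * U.card)
    (A B : Finset V) (hB : B.card ≤ m) :
    2 * A.card ≤ (G.interedges A Bᶜ).card + 2 * B.card + (G.defect + G.lowExcess k) := by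
  have hsplit : ∀ v, (B.filter fun w => G.Adj v w).card + (Bᶜ.filter fun w => G.Adj v w).card =
      G.degree v := by
    intro v
    rw [← card_neighborFinset_eq_degree, neighborFinset_eq_filter, ← Finset.card_union_of_disjoint
      (Finset.disjoint_filter_filter disjoint_compl_right), ← Finset.filter_union,
      Finset.union_compl]
  set Y := A.filter fun v => k < G.degree v ∧ (Bᶜ.filter fun w => G.Adj v w).card ≤ 1 with hYdef
  have hY : 2 * Y.card ≤ B.card := by
    refine card_high_degree_le G hk hk0 hsparse B hB Y fun v hv => ?_
    obtain ⟨-, h1, h2⟩ := Finset.mem_filter.1 hv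
    have := hsplit v
    omega
  have hlow : ∑ v ∈ G.lowDegree k, (B.filter fun w => G.Adj v w).card ≤
      B.card + G.lowExcess k := by
    have h1 : ∑ v ∈ G.lowDegree k, (B.filter fun w => G.Adj v w).card =
        ∑ b ∈ B, (G.neighborFinset b ∩ G.lowDegree k).card := by
      simp only [Finset.card_filter]
      rw [Finset.sum_comm]
      refine Finset.sum_congr rfl fun b _ => ?_
      rw [← Finset.card_filter]
      congr 1
      ext v
      simp [adj_comm, and_comm]
    rw [h1]
    have h2 : ∑ b ∈ B, (G.neighborFinset b ∩ G.lowDegree k).card ≤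
        ∑ b ∈ B, (1 + ((G.neighborFinset b ∩ G.lowDegree k).card - 1)) :=
      Finset.sum_le_sum fun b _ => by omega
    refine h2.trans ?_
    rw [Finset.sum_add_distrib]
    simp only [Finset.sum_const, smul_eq_mul, mul_one]
    apply Nat.add_le_add_left
    unfold lowExcess
    refine (Finset.sum_le_sum_of_subset (Finset.subset_univ B)).trans (le_of_eq ?_)
    refine Finset.sum_congr rfl fun b _ => ?_
    congr!
  have hA : 2 * A.card ≤ ∑ v ∈ A, ((Bᶜ.filter fun w => G.Adj v w).card + (2 - G.degree v) +
      (if v ∈ G.lowDegree k then (B.filter fun w => G.Adj v w).card else 0) +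
      2 * if v ∈ Y then 1 else 0) := by
    rw [mul_comm, ← smul_eq_mul]
    refine Finset.card_nsmul_le_sum _ _ _ fun v hv => ?_
    have h1 := hsplit v
    by_cases hvk : G.degree v ≤ k
    · have : v ∈ G.lowDegree k := by
        unfold lowDegree
        simp only [Finset.mem_filter, Finset.mem_univ, true_and]
        convert hvk
      rw [if_pos this]
      omega
    · by_cases hv2 : (Bᶜ.filter fun w => G.Adj v w).card ≤ 1
      · have : v ∈ Y := Finset.mem_filter.2 ⟨hv, by omega, hv2⟩
        rw [if_pos this]
        omega
      · omega
  rw [Finset.sum_add_distrib, Finset.sum_add_distrib, Finset.sum_add_distrib,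
    ← card_interedges_eq_sum, ← Finset.mul_sum, ← Finset.card_filter] at hA
  have h1 : (A.filter fun v => v ∈ Y).card ≤ Y.card :=
    Finset.card_le_card fun v hv => (Finset.mem_filter.1 hv).2
  have h2 : ∑ v ∈ A, (2 - G.degree v) ≤ G.defect := by
    unfold defect
    refine (Finset.sum_le_sum_of_subset (Finset.subset_univ A)).trans (le_of_eq ?_)
    refine Finset.sum_congr rfl fun b _ => ?_
    congr!
  have h3 : ∑ v ∈ A, (if v ∈ G.lowDegree k then (B.filter fun w => G.Adj v w).card else 0) ≤
      ∑ v ∈ G.lowDegree k, (B.filter fun w => G.Adj v w).card := by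
    rw [← Finset.sum_filter]
    exact Finset.sum_le_sum_of_subset fun v hv => (Finset.mem_filter.1 hv).2
  omega

/-- The cut condition holds in a locally sparse graph in which large sets span many edges. Cuts with
few vertices on one side are controlled by local sparsity, the others by the large sets. -/
theorem cut_le {k m r : ℕ} (hk : 6 * r ≤ k) (hk0 : 0 < k)
    (hsparse : ∀ U : Finset V, U.Nonempty → U.card ≤ 2 * m →
      (G.interedges U U).card < 2 * r * U.card)
    (hlarge : ∀ A C : Finset V, m ≤ A.card → m ≤ C.card →
      2 * Fintype.card V ≤ (G.interedges A C).card)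
    (A B : Finset V) :
    2 * A.card ≤ (G.interedges A Bᶜ).card + 2 * B.card + (G.defect + G.lowExcess k) := by
  by_cases hB : B.card ≤ m
  · exact cut_le_of_card_le G hk hk0 hsparse A B hB
  have hA := Finset.card_add_card_compl A
  have hBc := Finset.card_add_card_compl B
  by_cases hAc : Aᶜ.card ≤ m
  · have := cut_le_of_card_le G hk hk0 hsparse Bᶜ Aᶜ hAc
    rw [compl_compl] at this
    have : Std.Symm G.Adj := ⟨fun _ _ h => h.symm⟩
    have hcomm : (G.interedges Bᶜ A).card = (G.interedges A Bᶜ).card :=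
      Rel.card_interedges_comm _ _
    omega
  by_cases hAB : A.card ≤ B.card
  · omega
  have := hlarge A Bᶜ (by omega) (by omega)
  omega

end Cut

end SimpleGraph

/-! ### Expectations over random subsets and random graphs -/

section Bernoulli

variable {ι : Type*} [DecidableEq ι]

/-- The expectation of `f` over a random subset of `U` that contains every element independently
with probability `p`. -/
noncomputable def bernoulliExp (p : ℝ) (U : Finset ι) (f : Finset ι → ℝ) : ℝ :=
  ∑ K ∈ U.powerset, p ^ K.card * (1 - p) ^ (U \ K).card * f K

theorem bernoulliExp_insert (p : ℝ) {U : Finset ι} {a : ι} (ha : a ∉ U) (f : Finset ι → ℝ) :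
    bernoulliExp p (insert a U) f =
      bernoulliExp p U fun K => (1 - p) * f K + p * f (insert a K) := by
  unfold bernoulliExp
  rw [Finset.sum_powerset_insert ha, ← Finset.sum_add_distrib]
  refine Finset.sum_congr rfl fun K hK => ?_
  have haK : a ∉ K := fun h => ha (Finset.mem_powerset.1 hK h)
  rw [Finset.insert_sdiff_of_notMem _ haK, Finset.card_insert_of_notMem (by simp [ha]),
    Finset.card_insert_of_notMem haK, Finset.insert_sdiff_insert, Finset.sdiff_insert_of_notMem ha]
  ring

theorem bernoulliExp_add (p : ℝ) (U : Finset ι) (f g : Finset ι → ℝ) :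
    bernoulliExp p U (fun K => f K + g K) = bernoulliExp p U f + bernoulliExp p U g := by
  simp only [bernoulliExp, mul_add, Finset.sum_add_distrib]

theorem bernoulliExp_const_mul (p : ℝ) (U : Finset ι) (c : ℝ) (f : Finset ι → ℝ) :
    bernoulliExp p U (fun K => c * f K) = c * bernoulliExp p U f := by
  simp only [bernoulliExp, Finset.mul_sum]
  refine Finset.sum_congr rfl fun K _ => ?_
  ring

theorem bernoulliExp_sum {κ : Type*} (p : ℝ) (U : Finset ι) (s : Finset κ)
    (f : κ → Finset ι → ℝ) :
    bernoulliExp p U (fun K => ∑ i ∈ s, f i K) = ∑ i ∈ s, bernoulliExp p U (f i) := by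
  simp only [bernoulliExp, Finset.mul_sum]
  exact Finset.sum_comm

theorem bernoulliExp_mono {p : ℝ} (hp0 : 0 ≤ p) (hp1 : p ≤ 1) {U : Finset ι}
    {f g : Finset ι → ℝ} (h : ∀ K ⊆ U, f K ≤ g K) :
    bernoulliExp p U f ≤ bernoulliExp p U g := by
  unfold bernoulliExp
  refine Finset.sum_le_sum fun K hK => ?_
  have : 0 ≤ 1 - p := by linarith
  exact mul_le_mul_of_nonneg_left (h K (Finset.mem_powerset.1 hK)) (by positivity)

theorem bernoulliExp_congr (p : ℝ) {U : Finset ι} {f g : Finset ι → ℝ} (h : ∀ K ⊆ U, f K = g K) :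
    bernoulliExp p U f = bernoulliExp p U g :=
  Finset.sum_congr rfl fun K hK => by rw [h K (Finset.mem_powerset.1 hK)]

/-- Expectations of products of functions of the single coordinates factor. -/
theorem bernoulliExp_prod (p : ℝ) {U D : Finset ι} (hD : D ⊆ U) (x y : ι → ℝ) :
    bernoulliExp p U (fun K => ∏ e ∈ D, if e ∈ K then x e else y e) =
      ∏ e ∈ D, (p * x e + (1 - p) * y e) := by
  have h1 : ∏ e ∈ D, (p * x e + (1 - p) * y e) =
      ∏ e ∈ U, (p * (if e ∈ D then x e else 1) + (1 - p) * (if e ∈ D then y e else 1)) := by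
    rw [← Finset.prod_subset hD]
    · refine Finset.prod_congr rfl fun e he => ?_
      rw [if_pos he, if_pos he]
    · intro e _ he
      rw [if_neg he, if_neg he]
      ring
  rw [h1, Finset.prod_add]
  unfold bernoulliExp
  refine Finset.sum_congr rfl fun K hK => ?_
  have hKU := Finset.mem_powerset.1 hK
  have h2 : (∏ e ∈ D, if e ∈ K then x e else y e) =
      ∏ e ∈ U, if e ∈ K then (if e ∈ D then x e else 1) else (if e ∈ D then y e else 1) := by
    rw [← Finset.prod_subset hD]
    · refine Finset.prod_congr rfl fun e he => ?_
      rw [if_pos he, if_pos he]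
    · intro e _ he
      rw [if_neg he, if_neg he, ite_self]
  beta_reduce
  rw [h2, Finset.prod_mul_distrib, Finset.prod_mul_distrib, Finset.prod_const, Finset.prod_const,
    Finset.prod_ite]
  have h3 : U.filter (fun e => e ∈ K) = K := by
    rw [Finset.filter_mem_eq_inter, Finset.inter_eq_right.2 hKU]
  have h4 : U.filter (fun e => e ∉ K) = U \ K := by
    rw [Finset.filter_notMem_eq_sdiff]
  rw [h3, h4]
  ring

theorem bernoulliExp_const (p : ℝ) (U : Finset ι) (c : ℝ) :
    bernoulliExp p U (fun _ => c) = c := by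
  have h := bernoulliExp_prod p (Finset.empty_subset U) (fun _ => (1 : ℝ)) (fun _ => 1)
  have h2 := bernoulliExp_const_mul p U c (fun _ => 1)
  simp only [Finset.prod_empty] at h
  rw [h] at h2
  simpa using h2

/-- The variance of a function that changes by at most `C` when one element is added or removed is
at most `p * C ^ 2` times the number of elements: the Efron–Stein inequality. -/
theorem bernoulliExp_sq_le {p : ℝ} (hp0 : 0 ≤ p) (hp1 : p ≤ 1) (C : ℝ) (U : Finset ι)
    (f : Finset ι → ℝ) (hf : ∀ K, ∀ e ∈ U, |f (insert e K) - f (K.erase e)| ≤ C) :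
    bernoulliExp p U (fun K => f K ^ 2) ≤ bernoulliExp p U f ^ 2 + p * U.card * C ^ 2 := by
  induction U using Finset.induction_on generalizing f with
  | empty => simp [bernoulliExp]
  | insert a U ha ih =>
    have hp1' : 0 ≤ 1 - p := by linarith
    rw [bernoulliExp_insert p ha, bernoulliExp_insert p ha]
    have hg := ih (fun K => (1 - p) * f K + p * f (insert a K)) (by
      intro K e he
      have hea : e ≠ a := fun h => ha (h ▸ he)
      have h1 := hf K e (Finset.mem_insert_of_mem he)
      have h2 := hf (insert a K) e (Finset.mem_insert_of_mem he)
      rw [Finset.erase_insert_of_ne hea.symm, Finset.insert_comm] at h2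
      rw [abs_le] at h1 h2 ⊢
      constructor <;> nlinarith [mul_le_mul_of_nonneg_left h1.1 hp1',
        mul_le_mul_of_nonneg_left h1.2 hp1', mul_le_mul_of_nonneg_left h2.1 hp0,
        mul_le_mul_of_nonneg_left h2.2 hp0])
    have hstep : bernoulliExp p U (fun K => (1 - p) * f K ^ 2 + p * f (insert a K) ^ 2) ≤
        bernoulliExp p U (fun K => ((1 - p) * f K + p * f (insert a K)) ^ 2 + p * C ^ 2) := by
      refine bernoulliExp_mono hp0 hp1 fun K hK => ?_
      have haK : a ∉ K := fun h => ha (hK h)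
      have h1 := hf K a (Finset.mem_insert_self a U)
      rw [Finset.erase_eq_of_notMem haK] at h1
      have h2 : (f (insert a K) - f K) ^ 2 ≤ C ^ 2 := sq_le_sq' (abs_le.1 h1).1 (abs_le.1 h1).2
      have h3 : p * (1 - p) * (f (insert a K) - f K) ^ 2 ≤ p * C ^ 2 := by
        have h4 : p * (1 - p) ≤ p := by nlinarith
        calc p * (1 - p) * (f (insert a K) - f K) ^ 2 ≤ p * (f (insert a K) - f K) ^ 2 :=
              mul_le_mul_of_nonneg_right h4 (sq_nonneg _)
          _ ≤ p * C ^ 2 := mul_le_mul_of_nonneg_left h2 hp0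
      nlinarith
    rw [bernoulliExp_add p U (fun K => ((1 - p) * f K + p * f (insert a K)) ^ 2)
      (fun _ => p * C ^ 2), bernoulliExp_const] at hstep
    rw [Finset.card_insert_of_notMem ha]
    push_cast
    linarith

end Bernoulli

namespace SimpleGraph

section RandomGraph

variable {V : Type*} [Fintype V] [DecidableEq V]

/-- The expectation of `f` over the random graph with edge probability `p`. -/
noncomputable def edgeExp (p : ℝ) (f : SimpleGraph V → ℝ) : ℝ :=
  bernoulliExp p (⊤ : SimpleGraph V).edgeFinset fun K => f (fromEdgeSet (K : Set (Sym2 V)))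

open Classical in
/-- The probability of the event `P` for the random graph with edge probability `p`. -/
noncomputable def edgeProb (p : ℝ) (P : SimpleGraph V → Prop) : ℝ :=
  edgeExp p fun G => if P G then 1 else 0

theorem edgeExp_add (p : ℝ) (f g : SimpleGraph V → ℝ) :
    edgeExp p (fun G => f G + g G) = edgeExp p f + edgeExp p g :=
  bernoulliExp_add ..

theorem edgeExp_const_mul (p : ℝ) (c : ℝ) (f : SimpleGraph V → ℝ) :
    edgeExp p (fun G => c * f G) = c * edgeExp p f :=
  bernoulliExp_const_mul ..

theorem edgeExp_sum {κ : Type*} (p : ℝ) (s : Finset κ) (f : κ → SimpleGraph V → ℝ) :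
    edgeExp p (fun G => ∑ i ∈ s, f i G) = ∑ i ∈ s, edgeExp p (f i) :=
  bernoulliExp_sum ..

theorem edgeExp_const (p : ℝ) (c : ℝ) : edgeExp p (fun _ : SimpleGraph V => c) = c :=
  bernoulliExp_const ..

theorem edgeExp_mono {p : ℝ} (hp0 : 0 ≤ p) (hp1 : p ≤ 1) {f g : SimpleGraph V → ℝ}
    (h : ∀ G, f G ≤ g G) : edgeExp p f ≤ edgeExp p g :=
  bernoulliExp_mono hp0 hp1 fun _ _ => h _

theorem edgeExp_prod (p : ℝ) {D : Finset (Sym2 V)} (hD : ∀ e ∈ D, ¬ e.IsDiag)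
    (x y : Sym2 V → ℝ) [∀ G : SimpleGraph V, DecidablePred (· ∈ G.edgeSet)] :
    edgeExp p (fun G => ∏ e ∈ D, if e ∈ G.edgeSet then x e else y e) =
      ∏ e ∈ D, (p * x e + (1 - p) * y e) := by
  have hD' : D ⊆ (⊤ : SimpleGraph V).edgeFinset := by
    intro e he
    simpa using hD e he
  rw [← bernoulliExp_prod p hD']
  refine bernoulliExp_congr p fun K hK => Finset.prod_congr rfl fun e he => ?_
  have : e ∈ (fromEdgeSet (K : Set (Sym2 V))).edgeSet ↔ e ∈ K := by
    rw [edgeSet_fromEdgeSet]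
    simp [hD e he]
  simp only [this]

theorem edgeProb_le_edgeExp {p : ℝ} (hp0 : 0 ≤ p) (hp1 : p ≤ 1) {P : SimpleGraph V → Prop}
    {f : SimpleGraph V → ℝ} (hf : ∀ G, 0 ≤ f G) (h : ∀ G, P G → 1 ≤ f G) :
    edgeProb p P ≤ edgeExp p f := by
  refine edgeExp_mono hp0 hp1 fun G => ?_
  split_ifs with hP
  · exact h G hP
  · exact hf G

theorem edgeProb_nonneg {p : ℝ} (hp0 : 0 ≤ p) (hp1 : p ≤ 1) (P : SimpleGraph V → Prop) :
    0 ≤ edgeProb p P := by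
  rw [← edgeExp_const (V := V) p 0]
  refine edgeExp_mono hp0 hp1 fun G => ?_
  split_ifs <;> norm_num

theorem edgeProb_mono {p : ℝ} (hp0 : 0 ≤ p) (hp1 : p ≤ 1) {P Q : SimpleGraph V → Prop}
    (h : ∀ G, P G → Q G) : edgeProb p P ≤ edgeProb p Q := by
  refine edgeProb_le_edgeExp hp0 hp1 (fun G => by split_ifs <;> norm_num) fun G hG => ?_
  rw [if_pos (h G hG)]

theorem edgeProb_exists_le {κ : Type*} {p : ℝ} (hp0 : 0 ≤ p) (hp1 : p ≤ 1) (s : Finset κ)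
    (P : κ → SimpleGraph V → Prop) :
    edgeProb p (fun G => ∃ i ∈ s, P i G) ≤ ∑ i ∈ s, edgeProb p (P i) := by
  classical
  unfold edgeProb
  rw [← edgeExp_sum]
  refine edgeProb_le_edgeExp hp0 hp1 (fun G => Finset.sum_nonneg fun i _ => by
    split_ifs <;> norm_num) fun G => ?_
  rintro ⟨i, hi, hP⟩
  have := Finset.single_le_sum (f := fun i => if P i G then (1 : ℝ) else 0)
    (fun i _ => by split_ifs <;> norm_num) hi
  rwa [if_pos hP] at this

theorem edgeProb_or_le {p : ℝ} (hp0 : 0 ≤ p) (hp1 : p ≤ 1) (P Q : SimpleGraph V → Prop) :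
    edgeProb p (fun G => P G ∨ Q G) ≤ edgeProb p P + edgeProb p Q := by
  unfold edgeProb
  rw [← edgeExp_add]
  refine edgeProb_le_edgeExp hp0 hp1 (fun G => by split_ifs <;> norm_num) fun G => ?_
  rintro (h | h)
  · rw [if_pos h]
    split_ifs <;> norm_num
  · rw [if_pos h]
    split_ifs <;> norm_num

/-- Chebyshev's inequality for a graph parameter that changes by at most `C` when an edge is added
or removed. -/
theorem edgeProb_abs_sub_ge_le {p : ℝ} (hp0 : 0 ≤ p) (hp1 : p ≤ 1) (C t : ℝ) (ht : 0 < t)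
    (f : SimpleGraph V → ℝ)
    (hf : ∀ (G : SimpleGraph V) (a b : V), a ≠ b → |f (G ⊔ edge a b) - f (G \ edge a b)| ≤ C) :
    edgeProb p (fun G => t ≤ |f G - edgeExp p f|) ≤
      p * (Fintype.card V) ^ 2 * C ^ 2 / t ^ 2 := by
  set μ := edgeExp p f with hμ
  have h1 : edgeProb p (fun G => t ≤ |f G - μ|) ≤
      edgeExp p (fun G => 1 / t ^ 2 * (f G ^ 2 + ((-2 * μ) * f G + μ ^ 2))) := by
    have heq : ∀ G, f G ^ 2 + ((-2 * μ) * f G + μ ^ 2) = (f G - μ) ^ 2 := fun G => by ring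
    simp only [heq]
    refine edgeProb_le_edgeExp hp0 hp1 (fun G => by positivity) fun G hG => ?_
    rw [one_div, ← div_eq_inv_mul, le_div_iff₀ (by positivity), one_mul, ← sq_abs (f G - μ)]
    exact pow_le_pow_left₀ ht.le hG 2
  rw [edgeExp_const_mul, edgeExp_add, edgeExp_add, edgeExp_const_mul, edgeExp_const, ← hμ] at h1
  have h2 : edgeExp p (fun G => f G ^ 2) ≤
      μ ^ 2 + p * (⊤ : SimpleGraph V).edgeFinset.card * C ^ 2 := by
    refine bernoulliExp_sq_le hp0 hp1 C _ _ fun K e he => ?_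
    induction e with | _ a b =>
    have hab : a ≠ b := by simpa using he
    have h3 := hf (fromEdgeSet (K : Set (Sym2 V))) a b hab
    have h4 : fromEdgeSet (K : Set (Sym2 V)) ⊔ edge a b =
        fromEdgeSet ((insert s(a, b) K : Finset (Sym2 V)) : Set (Sym2 V)) := by
      rw [edge, ← fromEdgeSet_union, Finset.coe_insert, Set.union_singleton]
    have h5 : fromEdgeSet (K : Set (Sym2 V)) \ edge a b =
        fromEdgeSet ((K.erase s(a, b) : Finset (Sym2 V)) : Set (Sym2 V)) := by
      rw [edge, ← fromEdgeSet_sdiff, Finset.coe_erase]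
    rw [h4, h5] at h3
    exact h3
  have h6 : ((⊤ : SimpleGraph V).edgeFinset.card : ℝ) ≤ (Fintype.card V : ℝ) ^ 2 := by
    have := card_edgeFinset_top_eq_card_choose_two (V := V)
    rw [this]
    have := Nat.choose_le_pow (Fintype.card V) 2
    exact_mod_cast this
  refine h1.trans ?_
  rw [div_eq_mul_one_div (p * _ * _) (t ^ 2), mul_comm _ (1 / t ^ 2)]
  have h8 : (0 : ℝ) ≤ 1 / t ^ 2 := by positivity
  refine mul_le_mul_of_nonneg_left ?_ h8
  have h7 : p * ((⊤ : SimpleGraph V).edgeFinset.card : ℝ) * C ^ 2 ≤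
      p * (Fintype.card V : ℝ) ^ 2 * C ^ 2 := by gcongr
  linarith

end RandomGraph

open Classical in
/-- The law `gnp` in terms of the finite weighted sums defining `edgeProb`. -/
theorem gnp_real_apply (n : ℕ) {p : ℝ} (hp0 : 0 ≤ p) (hp1 : p ≤ 1)
    (S : Set (SimpleGraph (Fin n))) :
    (gnp n p).real S = edgeProb p (fun G => G ∈ S) := by
  have hI : ((Set.projIcc (0 : ℝ) 1 zero_le_one p : unitInterval) : ℝ) = p := by
    rw [Set.projIcc_of_mem zero_le_one ⟨hp0, hp1⟩]
  have h1 : (gnp n p).real S = ∑ G : SimpleGraph (Fin n), if G ∈ S then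
      p ^ G.edgeFinset.card * (1 - p) ^ ((⊤ : SimpleGraph (Fin n)).edgeFinset \ G.edgeFinset).card
      else 0 := by
    have hsing : MeasurableSingletonClass (SimpleGraph (Fin n)) := ⟨fun G => by
      have : ({G} : Set (SimpleGraph (Fin n))) = edgeSet ⁻¹' {G.edgeSet} := by
        ext G'
        simp
      rw [this]
      exact measurableEmbedding_edgeSet.measurable (MeasurableSet.singleton _)⟩
    have hprob : IsProbabilityMeasure (gnp n p) := by
      unfold gnp
      infer_instance
    have : S = ((Finset.univ.filter fun G => G ∈ S : Finset (SimpleGraph (Fin n))) :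
        Set (SimpleGraph (Fin n))) := by simp
    conv_lhs => rw [this]
    rw [← sum_measureReal_singleton, Finset.sum_filter]
    refine Finset.sum_congr rfl fun G _ => ?_
    congr 1
    rw [measureReal_def, gnp, binomialRandom_singleton,
      Finset.card_sdiff_of_subset (edgeFinset_mono le_top),
      card_edgeFinset_top_eq_card_choose_two, Set.ncard_eq_toFinset_card', ← edgeFinset]
    have hσ : ((unitInterval.symm (Set.projIcc (0 : ℝ) 1 zero_le_one p) : unitInterval) : ℝ) =
        1 - p := by rw [unitInterval.coe_symm_eq, hI]
    simp only [ENNReal.toReal_mul, ENNReal.toReal_pow, ENNReal.coe_toReal,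
      unitInterval.coe_toNNReal, hI, hσ, Nat.card_eq_fintype_card]
  rw [h1]
  unfold edgeProb edgeExp bernoulliExp
  refine Finset.sum_bij' (fun G _ => G.edgeFinset) (fun K _ => fromEdgeSet (K : Set (Sym2 (Fin n))))
    ?_ ?_ ?_ ?_ ?_
  · intro G _
    exact Finset.mem_powerset.2 (edgeFinset_mono le_top)
  · intro K _
    exact Finset.mem_univ _
  · intro G _
    simp
  · intro K hK
    have hK' := Finset.mem_powerset.1 hK
    ext e
    simp only [mem_edgeFinset, edgeSet_fromEdgeSet, Set.mem_sdiff, Finset.mem_coe]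
    refine ⟨fun h => h.1, fun h => ⟨h, ?_⟩⟩
    simpa using hK' h
  · intro G _
    simp

end SimpleGraph

/-! ### Bounded increments and exact means -/

namespace SimpleGraph

section Lipschitz

variable {V : Type*} [Fintype V]

omit [Fintype V] in
theorem neighborFinset_congr {G₁ G₂ : SimpleGraph V} {s : V} [Fintype (G₁.neighborSet s)]
    [Fintype (G₂.neighborSet s)] (h : ∀ v, G₁.Adj s v ↔ G₂.Adj s v) :
    G₁.neighborFinset s = G₂.neighborFinset s := by
  ext v
  simp [h]

omit [Fintype V] in
theorem sup_edge_adj_iff_sdiff_edge_adj {G : SimpleGraph V} {a b s : V} (ha : s ≠ a) (hb : s ≠ b)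
    (v : V) : (G ⊔ edge a b).Adj s v ↔ (G \ edge a b).Adj s v := by
  simp only [sup_adj, sdiff_adj, edge_adj]
  tauto

open Classical in
theorem degree_sup_edge_le {G : SimpleGraph V} {a b : V} (s : V) :
    (G \ edge a b).degree s ≤ (G ⊔ edge a b).degree s ∧
      (G ⊔ edge a b).degree s ≤ (G \ edge a b).degree s + 1 := by
  constructor
  · exact degree_le_of_le (sdiff_le.trans le_sup_left)
  · by_cases h : s = a ∨ s = b
    · obtain ⟨c, hc⟩ : ∃ c, ∀ v, (edge a b).Adj s v → v = c := by
        rcases h with rfl | rfl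
        · refine ⟨b, fun v hv => ?_⟩
          rw [edge_adj] at hv
          rcases hv.1 with h | h
          · exact h.2
          · exact absurd h.2.symm hv.2
        · refine ⟨a, fun v hv => ?_⟩
          rw [edge_adj] at hv
          rcases hv.1 with h | h
          · exact absurd h.2.symm hv.2
          · exact h.2
      rw [← card_neighborFinset_eq_degree, ← card_neighborFinset_eq_degree]
      refine (Finset.card_le_card ?_).trans (Finset.card_insert_le c _)
      intro v hv
      rw [mem_neighborFinset, sup_adj] at hv
      rw [Finset.mem_insert, mem_neighborFinset, sdiff_adj]
      by_cases hv' : (edge a b).Adj s v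
      · exact Or.inl (hc v hv')
      · exact Or.inr ⟨hv.resolve_right hv', hv'⟩
    · push Not at h
      rw [← card_neighborFinset_eq_degree, ← card_neighborFinset_eq_degree,
        neighborFinset_congr (sup_edge_adj_iff_sdiff_edge_adj h.1 h.2)]
      omega

open Classical in
/-- Degree sums of a 1-Lipschitz function have increments at most two. -/
theorem abs_sum_degree_sub_le (φ : ℕ → ℝ) (hφ : ∀ d, |φ (d + 1) - φ d| ≤ 1)
    (G : SimpleGraph V) (a b : V) :
    |∑ v, φ ((G ⊔ edge a b).degree v) - ∑ v, φ ((G \ edge a b).degree v)| ≤ 2 := by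
  rw [← Finset.sum_sub_distrib]
  have h1 : ∀ v, |φ ((G ⊔ edge a b).degree v) - φ ((G \ edge a b).degree v)| ≤
      (if v = a then 1 else 0) + (if v = b then 1 else 0) := by
    intro v
    by_cases h : v = a ∨ v = b
    · have h2 := degree_sup_edge_le (G := G) (a := a) (b := b) v
      have h3 : |φ ((G ⊔ edge a b).degree v) - φ ((G \ edge a b).degree v)| ≤ 1 := by
        rcases Nat.lt_or_ge ((G \ edge a b).degree v) ((G ⊔ edge a b).degree v) with h4 | h4
        · rw [show (G ⊔ edge a b).degree v = (G \ edge a b).degree v + 1 by omega]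
          exact hφ _
        · rw [show (G ⊔ edge a b).degree v = (G \ edge a b).degree v by omega]
          simp
      refine h3.trans ?_
      rcases h with rfl | rfl
      · rw [if_pos rfl]
        split_ifs <;> norm_num
      · rw [if_pos rfl]
        split_ifs <;> norm_num
    · push Not at h
      have : (G ⊔ edge a b).degree v = (G \ edge a b).degree v := by
        rw [← card_neighborFinset_eq_degree, ← card_neighborFinset_eq_degree,
          neighborFinset_congr (sup_edge_adj_iff_sdiff_edge_adj h.1 h.2)]
      rw [this, if_neg h.1, if_neg h.2]
      simp
  refine (Finset.abs_sum_le_sum_abs _ _).trans ((Finset.sum_le_sum fun v _ => h1 v).trans ?_)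
  rw [Finset.sum_add_distrib]
  simp
  norm_num

open Classical in
/-- Changing the edges at two vertices changes the number of low-degree neighbours only in pairs
containing one of the two vertices while it has low degree. -/
theorem lowExcess_le_add {G₁ G₂ : SimpleGraph V} {a b : V} (k : ℕ)
    (h : ∀ s, s ≠ a → s ≠ b → ∀ v, G₁.Adj s v ↔ G₂.Adj s v) :
    G₂.lowExcess k ≤ G₁.lowExcess k + 2 * k := by
  have h1 : ∀ v, (G₂.neighborFinset v ∩ G₂.lowDegree k).card ≤
      (G₁.neighborFinset v ∩ G₁.lowDegree k).card +
      (if G₂.Adj v a ∧ G₂.degree a ≤ k then 1 else 0) +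
      (if G₂.Adj v b ∧ G₂.degree b ≤ k then 1 else 0) := by
    intro v
    have hsub : G₂.neighborFinset v ∩ G₂.lowDegree k ⊆ (G₁.neighborFinset v ∩ G₁.lowDegree k) ∪
        (({a} : Finset V).filter fun s => G₂.Adj v s ∧ G₂.degree s ≤ k) ∪
        (({b} : Finset V).filter fun s => G₂.Adj v s ∧ G₂.degree s ≤ k) := by
      intro s hs
      simp only [lowDegree, Finset.mem_inter, mem_neighborFinset, Finset.mem_filter,
        Finset.mem_univ, true_and] at hs
      simp only [lowDegree, Finset.mem_union, Finset.mem_inter, mem_neighborFinset,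
        Finset.mem_filter, Finset.mem_univ, true_and, Finset.mem_singleton]
      by_cases hsa : s = a
      · exact Or.inl (Or.inr ⟨hsa, hs⟩)
      by_cases hsb : s = b
      · exact Or.inr ⟨hsb, hs⟩
      refine Or.inl (Or.inl ⟨?_, ?_⟩)
      · exact ((h s hsa hsb v).2 hs.1.symm).symm
      · rw [← card_neighborFinset_eq_degree, neighborFinset_congr (h s hsa hsb),
          card_neighborFinset_eq_degree]
        exact hs.2
    refine (Finset.card_le_card hsub).trans ((Finset.card_union_le _ _).trans ?_)
    refine Nat.add_le_add ((Finset.card_union_le _ _).trans (Nat.add_le_add le_rfl ?_)) ?_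
    · rw [Finset.filter_singleton]
      split_ifs <;> simp
    · rw [Finset.filter_singleton]
      split_ifs <;> simp
  have h2 : ∀ c, ∑ v, (if G₂.Adj v c ∧ G₂.degree c ≤ k then 1 else 0) ≤ k := by
    intro c
    rw [← Finset.card_filter]
    by_cases hc : G₂.degree c ≤ k
    · refine le_trans ?_ hc
      rw [← card_neighborFinset_eq_degree]
      apply Finset.card_le_card
      intro v hv
      rw [mem_neighborFinset]
      exact (Finset.mem_filter.1 hv).2.1.symm
    · simp [hc]
  have h3 : G₂.lowExcess k ≤ ∑ v, (((G₁.neighborFinset v ∩ G₁.lowDegree k).card - 1) +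
      (if G₂.Adj v a ∧ G₂.degree a ≤ k then 1 else 0) +
      (if G₂.Adj v b ∧ G₂.degree b ≤ k then 1 else 0)) := by
    unfold lowExcess
    refine Finset.sum_le_sum fun v _ => ?_
    have := h1 v
    omega
  rw [Finset.sum_add_distrib, Finset.sum_add_distrib] at h3
  have := h2 a
  have := h2 b
  unfold lowExcess at h3 ⊢
  omega

theorem abs_lowExcess_sub_le (k : ℕ) (G : SimpleGraph V) (a b : V) :
    |((G ⊔ edge a b).lowExcess k : ℝ) - ((G \ edge a b).lowExcess k : ℝ)| ≤ 2 * k := by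
  have h1 := lowExcess_le_add (G₁ := G \ edge a b) (G₂ := G ⊔ edge a b) (a := a) (b := b) k
    fun s ha hb v => (sup_edge_adj_iff_sdiff_edge_adj ha hb v).symm
  have h2 := lowExcess_le_add (G₁ := G ⊔ edge a b) (G₂ := G \ edge a b) (a := a) (b := b) k
    fun s ha hb v => sup_edge_adj_iff_sdiff_edge_adj ha hb v
  have h1' : ((G ⊔ edge a b).lowExcess k : ℝ) ≤ (G \ edge a b).lowExcess k + 2 * k := by
    exact_mod_cast h1
  have h2' : ((G \ edge a b).lowExcess k : ℝ) ≤ (G ⊔ edge a b).lowExcess k + 2 * k := by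
    exact_mod_cast h2
  rw [abs_le]
  constructor <;> linarith

end Lipschitz

section Expectations

variable {V : Type*} [Fintype V] [DecidableEq V]

/-- The pairs consisting of `v` and a vertex of `S`. -/
def star (v : V) (S : Finset V) : Finset (Sym2 V) := S.image fun w => s(v, w)

omit [Fintype V] in
theorem card_star (v : V) (S : Finset V) : (star v S).card = S.card :=
  Finset.card_image_of_injective _ fun _ _ h => Sym2.congr_right.1 h

omit [Fintype V] in
theorem not_isDiag_of_mem_star {v : V} {S : Finset V} (hv : v ∉ S) :
    ∀ e ∈ star v S, ¬ e.IsDiag := by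
  intro e he
  obtain ⟨w, hw, rfl⟩ := Finset.mem_image.1 he
  rw [Sym2.mk_isDiag_iff]
  rintro rfl
  exact hv hw

omit [Fintype V] in
theorem prod_star {M : Type*} [CommMonoid M] (v : V) (S : Finset V) (g : Sym2 V → M) :
    ∏ e ∈ star v S, g e = ∏ w ∈ S, g s(v, w) :=
  Finset.prod_image fun _ _ _ _ h => Sym2.congr_right.1 h

open Classical in
theorem edgeExp_degree_eq_zero (p : ℝ) (v : V) :
    edgeExp p (fun G : SimpleGraph V => if G.degree v = 0 then 1 else 0) =
      (1 - p) ^ (Fintype.card V - 1) := by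
  have h := edgeExp_prod p (not_isDiag_of_mem_star (Finset.notMem_erase v Finset.univ))
    (fun _ => (0 : ℝ)) (fun _ => 1)
  have h1 : ∀ G : SimpleGraph V, (∏ e ∈ star v (Finset.univ.erase v),
      if e ∈ G.edgeSet then (0 : ℝ) else 1) = if G.degree v = 0 then 1 else 0 := by
    intro G
    rw [prod_star]
    have : ∀ w, (if s(v, w) ∈ G.edgeSet then (0 : ℝ) else 1) = if ¬ G.Adj v w then 1 else 0 := by
      intro w
      by_cases h : G.Adj v w <;> simp [h]
    simp only [this]
    rw [Finset.prod_boole]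
    congr 1
    rw [← card_neighborFinset_eq_degree, Finset.card_eq_zero,
      Finset.eq_empty_iff_forall_notMem]
    simp only [Finset.mem_erase, Finset.mem_univ, and_true, mem_neighborFinset, eq_iff_iff]
    exact ⟨fun h w hw => h w hw.ne' hw, fun h w _ => h w⟩
  simp only [h1] at h
  rw [h, Finset.prod_const, card_star, Finset.card_erase_of_mem (Finset.mem_univ v),
    Finset.card_univ]
  ring

open Classical in
theorem edgeExp_degree_eq_one (p : ℝ) (v : V) :
    edgeExp p (fun G : SimpleGraph V => if G.degree v = 1 then 1 else 0) =
      (Fintype.card V - 1 : ℕ) * (p * (1 - p) ^ (Fintype.card V - 2)) := by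
  have h1 : ∀ G : SimpleGraph V, (if G.degree v = 1 then (1 : ℝ) else 0) =
      ∑ w ∈ Finset.univ.erase v, ∏ e ∈ star v (Finset.univ.erase v), if e ∈ G.edgeSet then
        (if e = s(v, w) then 1 else 0) else (if e = s(v, w) then 0 else 1) := by
    intro G
    have h2 : ∀ w, (∏ e ∈ star v (Finset.univ.erase v), if e ∈ G.edgeSet then
        (if e = s(v, w) then (1 : ℝ) else 0) else (if e = s(v, w) then 0 else 1)) =
        if (∀ w' ∈ Finset.univ.erase v, (G.Adj v w' ↔ w' = w)) then 1 else 0 := by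
      intro w
      rw [prod_star]
      trans ∏ w' ∈ Finset.univ.erase v, if (G.Adj v w' ↔ w' = w) then (1 : ℝ) else 0
      · refine Finset.prod_congr rfl fun w' _ => ?_
        simp only [mem_edgeSet, Sym2.congr_right]
        by_cases h1 : G.Adj v w' <;> by_cases h2 : w' = w <;> simp [h1, h2]
      · rw [Finset.prod_boole]
        congr
    simp only [h2]
    have h3 : ∀ w ∈ Finset.univ.erase v, (∀ w' ∈ Finset.univ.erase v, (G.Adj v w' ↔ w' = w)) ↔
        G.neighborFinset v = {w} := by
      intro w hw
      rw [Finset.ext_iff]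
      simp only [Finset.mem_erase, Finset.mem_univ, and_true, mem_neighborFinset,
        Finset.mem_singleton] at hw ⊢
      refine ⟨fun h w' => ?_, fun h w' _ => h w'⟩
      by_cases hv : w' = v
      · subst hv
        simp only [SimpleGraph.irrefl, false_iff]
        exact fun h => hw h.symm
      · exact h w' hv
    rw [Finset.sum_congr rfl fun w hw => by rw [if_congr (h3 w hw) rfl rfl]]
    by_cases hd : G.degree v = 1
    · rw [if_pos hd]
      rw [← card_neighborFinset_eq_degree, Finset.card_eq_one] at hd
      obtain ⟨w0, hw0⟩ := hd
      have hadj : G.Adj v w0 := by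
        rw [← mem_neighborFinset, hw0]
        simp
      simp only [hw0, Finset.singleton_inj]
      rw [Finset.sum_ite_eq, if_pos]
      simp [hadj.ne']
    · rw [if_neg hd, Finset.sum_eq_zero]
      intro w _
      rw [if_neg]
      intro h
      apply hd
      rw [← card_neighborFinset_eq_degree, h, Finset.card_singleton]
  simp only [h1]
  rw [edgeExp_sum]
  have h2 : ∀ w ∈ Finset.univ.erase v, edgeExp p (fun G : SimpleGraph V =>
      ∏ e ∈ star v (Finset.univ.erase v), if e ∈ G.edgeSet then
        (if e = s(v, w) then (1 : ℝ) else 0) else (if e = s(v, w) then 0 else 1)) =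
      p * (1 - p) ^ (Fintype.card V - 2) := by
    intro w hw
    rw [edgeExp_prod p (not_isDiag_of_mem_star (Finset.notMem_erase v Finset.univ)), prod_star]
    simp only [Sym2.congr_right]
    rw [← Finset.mul_prod_erase _ _ hw]
    rw [Finset.prod_congr rfl (g := fun _ => 1 - p)]
    · rw [Finset.prod_const, Finset.card_erase_of_mem hw,
        Finset.card_erase_of_mem (Finset.mem_univ v), Finset.card_univ]
      simp [Nat.sub_sub]
    · intro w' hw'
      simp [Finset.ne_of_mem_erase hw']
  rw [Finset.sum_congr rfl h2, Finset.sum_const, Finset.card_erase_of_mem (Finset.mem_univ v),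
    Finset.card_univ, nsmul_eq_mul]

open Classical in
theorem edgeExp_defect (p : ℝ) :
    edgeExp p (fun G : SimpleGraph V => (G.defect : ℝ)) = Fintype.card V *
      ((Fintype.card V - 1 : ℕ) * (p * (1 - p) ^ (Fintype.card V - 2)) +
        2 * (1 - p) ^ (Fintype.card V - 1)) := by
  have h1 : ∀ G : SimpleGraph V, (G.defect : ℝ) = ∑ v, ((if G.degree v = 1 then 1 else 0) +
      2 * (if G.degree v = 0 then 1 else 0)) := by
    intro G
    unfold defect
    push_cast
    refine Finset.sum_congr rfl fun v _ => ?_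
    rcases Nat.lt_or_ge (G.degree v) 2 with h | h
    · interval_cases hd : G.degree v <;> norm_num
    · rw [if_neg (by omega), if_neg (by omega), Nat.sub_eq_zero_of_le h]
      norm_num
  simp only [h1]
  rw [edgeExp_sum]
  simp only [edgeExp_add, edgeExp_const_mul, edgeExp_degree_eq_zero, edgeExp_degree_eq_one]
  rw [Finset.sum_const, Finset.card_univ, nsmul_eq_mul]

open Classical in
theorem edgeExp_card_degree_eq_one (p : ℝ) :
    edgeExp p (fun G : SimpleGraph V => ((Finset.univ.filter fun v => G.degree v = 1).card : ℝ)) =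
      Fintype.card V * ((Fintype.card V - 1 : ℕ) * (p * (1 - p) ^ (Fintype.card V - 2))) := by
  have h1 : ∀ G : SimpleGraph V, ((Finset.univ.filter fun v => G.degree v = 1).card : ℝ) =
      ∑ v, (if G.degree v = 1 then 1 else 0) := by
    intro G
    rw [Finset.card_filter]
    push_cast
    rfl
  simp only [h1]
  rw [edgeExp_sum]
  simp only [edgeExp_degree_eq_one]
  rw [Finset.sum_const, Finset.card_univ, nsmul_eq_mul]

end Expectations

end SimpleGraph

/-! ### Union bounds and rare structures -/

namespace SimpleGraph

open Classical in
/-- The vertices at which a cycle with at most `L` vertices starts. -/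
noncomputable def shortCycleHeads {V : Type*} [Fintype V] (G : SimpleGraph V) (L : ℕ) : Finset V :=
  Finset.univ.filter fun v => ∃ l, G.IsCycleList l ∧ l.length ≤ L ∧ v ∈ l.head?

/-- Every short cycle contains one of the vertices of `shortCycleHeads`. -/
theorem exists_mem_shortCycleHeads {V : Type*} [Fintype V] (G : SimpleGraph V) (L : ℕ) (l : List V)
    (hl : G.IsCycleList l) (hL : l.length ≤ L) : ∃ v ∈ l, v ∈ G.shortCycleHeads L := by
  obtain ⟨-, -, -, a, ha, -⟩ := id hl
  classical exact ⟨a, List.mem_of_mem_head? ha, by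
    unfold shortCycleHeads
    exact Finset.mem_filter.2 ⟨Finset.mem_univ _, l, hl, hL, ha⟩⟩

section Estimates

variable {V : Type*} [Fintype V] [DecidableEq V]

open Classical in
/-- Two vertices of degree at most `k` with a common neighbour are rare: their edges to the other
vertices are independent of each other and of the two edges to the common neighbour, and each of
the two degree conditions is weighted by a power of `x`. -/
theorem edgeExp_lowExcess_le {p x : ℝ} (hp0 : 0 ≤ p) (hp1 : p ≤ 1) (hx0 : 0 < x) (hx1 : x ≤ 1)
    (k : ℕ) :
    edgeExp p (fun G : SimpleGraph V => (G.lowExcess k : ℝ)) ≤ (Fintype.card V : ℝ) ^ 3 *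
      ((x ^ (2 * k))⁻¹ * (p ^ 2 * (p * x + (1 - p)) ^ (2 * (Fintype.card V - 3)))) := by
  let W : V × V × V → Finset V := fun q => Finset.univ \ {q.1, q.2.1, q.2.2}
  let D : V × V × V → Finset (Sym2 V) := fun q =>
    star q.1 {q.2.1, q.2.2} ∪ (star q.2.1 (W q) ∪ star q.2.2 (W q))
  let Φ : V × V × V → SimpleGraph V → ℝ := fun q G => (x ^ (2 * k))⁻¹ *
    ∏ e ∈ D q, if e ∈ G.edgeSet then (if e ∈ star q.1 {q.2.1, q.2.2} then 1 else x)
      else (if e ∈ star q.1 {q.2.1, q.2.2} then 0 else 1)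
  let T : V → Finset (V × V) := fun b =>
    Finset.univ.filter fun q => b ≠ q.1 ∧ b ≠ q.2 ∧ q.1 ≠ q.2
  have hdisj : ∀ b, ∀ q ∈ T b, Disjoint (star b {q.1, q.2})
      (star q.1 (W (b, q)) ∪ star q.2 (W (b, q))) ∧
      Disjoint (star q.1 (W (b, q))) (star q.2 (W (b, q))) := by
    rintro b ⟨s, s'⟩ hq
    simp only [T, Finset.mem_filter, Finset.mem_univ, true_and] at hq
    obtain ⟨h1, h2, h3⟩ := hq
    have hW : ∀ w, w ∈ W (b, s, s') → w ≠ b ∧ w ≠ s ∧ w ≠ s' := by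
      intro w hw
      simpa [W] using hw
    rw [Finset.disjoint_union_right]
    have key : ∀ u ∈ ({s, s'} : Finset V), Disjoint (star b {s, s'}) (star u (W (b, s, s'))) := by
      intro u hu
      rw [Finset.disjoint_left]
      intro e he he'
      obtain ⟨w, hw, rfl⟩ := Finset.mem_image.1 he
      obtain ⟨w', hw', h⟩ := Finset.mem_image.1 he'
      have := hW w' hw'
      rw [Finset.mem_insert, Finset.mem_singleton] at hu hw
      rcases Sym2.eq_iff.1 h with ⟨h, h'⟩ | ⟨h, h'⟩
      · rcases hu with rfl | rfl
        · exact h1 h.symm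
        · exact h2 h.symm
      · exact this.1 h'
    refine ⟨⟨key s (by simp), key s' (by simp)⟩, ?_⟩
    rw [Finset.disjoint_left]
    intro e he he'
    obtain ⟨w, hw, rfl⟩ := Finset.mem_image.1 he
    obtain ⟨w', hw', h⟩ := Finset.mem_image.1 he'
    rcases Sym2.eq_iff.1 h with ⟨h, h'⟩ | ⟨h, h'⟩
    · exact h3 h.symm
    · exact (hW w hw).2.2 h.symm
  have hfactor : ∀ b, ∀ q ∈ T b, ∀ g : Sym2 V → ℝ, ∏ e ∈ D (b, q), g e =
      (∏ e ∈ star b {q.1, q.2}, g e) *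
        ((∏ e ∈ star q.1 (W (b, q)), g e) * ∏ e ∈ star q.2 (W (b, q)), g e) := by
    intro b q hq g
    rw [Finset.prod_union (hdisj b q hq).1, Finset.prod_union (hdisj b q hq).2]
  have hnotin : ∀ b, ∀ q ∈ T b, ∀ e, e ∈ star q.1 (W (b, q)) ∨ e ∈ star q.2 (W (b, q)) →
      e ∉ star b {q.1, q.2} := by
    intro b q hq e he he'
    exact Finset.disjoint_left.1 (hdisj b q hq).1 he' (Finset.mem_union.2 he)
  have hWcard : ∀ b, ∀ q ∈ T b, (W (b, q)).card = Fintype.card V - 3 := by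
    rintro b ⟨s, s'⟩ hq
    simp only [T, Finset.mem_filter, Finset.mem_univ, true_and] at hq
    simp only [W]
    rw [Finset.card_sdiff_of_subset (Finset.subset_univ _), Finset.card_univ,
      Finset.card_eq_three.2 ⟨b, s, s', hq.1, hq.2.1, hq.2.2, rfl⟩]
  have hΦ0 : ∀ q G, 0 ≤ Φ q G := by
    intro q G
    refine mul_nonneg (by positivity) (Finset.prod_nonneg fun e _ => ?_)
    split_ifs <;> first | exact hx0.le | norm_num
  have hΦ1 : ∀ G : SimpleGraph V, ∀ b, ∀ q ∈ T b, G.Adj b q.1 → G.Adj b q.2 → G.degree q.1 ≤ k →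
      G.degree q.2 ≤ k → 1 ≤ Φ (b, q) G := by
    intro G b q hq h1 h2 h3 h4
    simp only [Φ]
    rw [hfactor b q hq]
    have e1 : (∏ e ∈ star b {q.1, q.2}, if e ∈ G.edgeSet then
        (if e ∈ star b {q.1, q.2} then (1 : ℝ) else x)
        else (if e ∈ star b {q.1, q.2} then 0 else 1)) = 1 := by
      refine Finset.prod_eq_one fun e he => ?_
      rw [if_pos, if_pos he]
      obtain ⟨w, hw, rfl⟩ := Finset.mem_image.1 he
      simp only [Finset.mem_insert, Finset.mem_singleton] at hw
      rcases hw with rfl | rfl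
      · exact h1
      · exact h2
    have e2 : ∀ s, G.degree s ≤ k → (∀ e ∈ star s (W (b, q)), e ∉ star b {q.1, q.2}) →
        x ^ k ≤ ∏ e ∈ star s (W (b, q)), if e ∈ G.edgeSet then
        (if e ∈ star b {q.1, q.2} then (1 : ℝ) else x)
        else (if e ∈ star b {q.1, q.2} then 0 else 1) := by
      intro s hs hns
      have : (∏ e ∈ star s (W (b, q)), if e ∈ G.edgeSet then
        (if e ∈ star b {q.1, q.2} then (1 : ℝ) else x)
        else (if e ∈ star b {q.1, q.2} then 0 else 1)) =
          ∏ e ∈ star s (W (b, q)), if e ∈ G.edgeSet then x else 1 := by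
        refine Finset.prod_congr rfl fun e he => ?_
        rw [if_neg (hns e he), if_neg (hns e he)]
      rw [this, prod_star, Finset.prod_ite, Finset.prod_const, Finset.prod_const_one, mul_one]
      refine pow_le_pow_of_le_one hx0.le hx1 (le_trans ?_ hs)
      rw [← card_neighborFinset_eq_degree]
      apply Finset.card_le_card
      intro w hw
      rw [mem_neighborFinset]
      exact (Finset.mem_filter.1 hw).2
    rw [e1, one_mul, pow_mul', sq, inv_mul_eq_div, one_le_div (by positivity)]
    exact mul_le_mul (e2 _ h3 fun e he => hnotin b q hq e (Or.inl he))
      (e2 _ h4 fun e he => hnotin b q hq e (Or.inr he)) (by positivity)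
      (le_trans (by positivity) (e2 _ h3 fun e he => hnotin b q hq e (Or.inl he)))
  have hpt : ∀ G : SimpleGraph V, (G.lowExcess k : ℝ) ≤ ∑ b, ∑ q ∈ T b, Φ (b, q) G := by
    intro G
    unfold lowExcess
    push_cast
    refine Finset.sum_le_sum fun b _ => ?_
    obtain ⟨N, hN⟩ : ∃ N, N = G.neighborFinset b ∩ G.lowDegree k := ⟨_, rfl⟩
    have h1 : N.card - 1 ≤ N.offDiag.card := by
      rw [Finset.offDiag_card]
      rcases Nat.eq_zero_or_pos N.card with h | h
      · rw [h]
      · rw [← Nat.mul_sub_one]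
        exact Nat.le_mul_of_pos_left _ h
    have h2 : N.offDiag ⊆ T b := by
      rintro ⟨s, s'⟩ hq
      rw [Finset.mem_offDiag] at hq
      simp only [hN, Finset.mem_inter, mem_neighborFinset] at hq
      simp only [T, Finset.mem_filter, Finset.mem_univ, true_and]
      exact ⟨hq.1.1.ne, hq.2.1.1.ne, hq.2.2⟩
    refine le_trans (b := ((N.card - 1 : ℕ) : ℝ)) (le_of_eq ?_) ?_
    · rw [hN]
      congr
      exact Subsingleton.elim _ _
    calc ((N.card - 1 : ℕ) : ℝ) ≤ (N.offDiag.card : ℝ) := by exact_mod_cast h1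
      _ = ∑ q ∈ N.offDiag, (1 : ℝ) := by simp
      _ ≤ ∑ q ∈ N.offDiag, Φ (b, q) G := by
          refine Finset.sum_le_sum fun q hq => ?_
          have hqT := h2 hq
          rw [Finset.mem_offDiag] at hq
          simp only [hN, lowDegree, Finset.mem_inter, mem_neighborFinset, Finset.mem_filter,
            Finset.mem_univ, true_and] at hq
          exact hΦ1 G b q hqT hq.1.1 hq.2.1.1 hq.1.2 hq.2.1.2
      _ ≤ ∑ q ∈ T b, Φ (b, q) G := Finset.sum_le_sum_of_subset_of_nonneg h2 fun q _ _ => hΦ0 _ _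
  have hE : ∀ b, ∀ q ∈ T b, edgeExp p (Φ (b, q)) =
      (x ^ (2 * k))⁻¹ * (p ^ 2 * (p * x + (1 - p)) ^ (2 * (Fintype.card V - 3))) := by
    intro b q hq
    have hq' := hq
    simp only [T, Finset.mem_filter, Finset.mem_univ, true_and] at hq'
    simp only [Φ]
    rw [edgeExp_const_mul, edgeExp_prod, hfactor b q hq]
    · have e1 : (∏ e ∈ star b {q.1, q.2}, (p * (if e ∈ star b {q.1, q.2} then (1 : ℝ) else x) +
          (1 - p) * (if e ∈ star b {q.1, q.2} then 0 else 1))) = p ^ 2 := by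
        rw [Finset.prod_congr rfl (g := fun _ => p), Finset.prod_const, card_star,
          Finset.card_pair hq'.2.2]
        intro e he
        rw [if_pos he, if_pos he]
        ring
      have e2 : ∀ s, (∀ e ∈ star s (W (b, q)), e ∉ star b {q.1, q.2}) →
          (∏ e ∈ star s (W (b, q)), (p * (if e ∈ star b {q.1, q.2} then (1 : ℝ) else x) +
          (1 - p) * (if e ∈ star b {q.1, q.2} then 0 else 1))) =
          (p * x + (1 - p)) ^ (Fintype.card V - 3) := by
        intro s hs
        rw [Finset.prod_congr rfl (g := fun _ => p * x + (1 - p)), Finset.prod_const, card_star,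
          hWcard b q hq]
        intro e he
        rw [if_neg (hs e he), if_neg (hs e he)]
        ring
      rw [e1, e2 _ fun e he => hnotin b q hq e (Or.inl he),
        e2 _ fun e he => hnotin b q hq e (Or.inr he), ← pow_add, ← two_mul (Fintype.card V - 3)]
    · intro e he
      rcases Finset.mem_union.1 he with he | he
      · exact not_isDiag_of_mem_star (by simp [hq'.1, hq'.2.1]) e he
      rcases Finset.mem_union.1 he with he | he
      · exact not_isDiag_of_mem_star (by simp [W]) e he
      · exact not_isDiag_of_mem_star (by simp [W]) e he
  refine (edgeExp_mono hp0 hp1 hpt).trans ?_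
  rw [edgeExp_sum]
  simp only [edgeExp_sum]
  have hval : 0 ≤ (x ^ (2 * k))⁻¹ * (p ^ 2 * (p * x + (1 - p)) ^ (2 * (Fintype.card V - 3))) := by
    have : 0 ≤ p * x + (1 - p) := by nlinarith
    positivity
  have hb : ∀ b, ∑ q ∈ T b, edgeExp p (Φ (b, q)) ≤ (Fintype.card V : ℝ) ^ 2 *
      ((x ^ (2 * k))⁻¹ * (p ^ 2 * (p * x + (1 - p)) ^ (2 * (Fintype.card V - 3)))) := by
    intro b
    rw [Finset.sum_congr rfl (hE b), Finset.sum_const, nsmul_eq_mul]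
    refine mul_le_mul_of_nonneg_right ?_ hval
    have : (T b).card ≤ Fintype.card V ^ 2 := by
      refine (Finset.card_le_univ _).trans ?_
      rw [Fintype.card_prod, sq]
    exact_mod_cast this
  refine (Finset.sum_le_sum fun b _ => hb b).trans ?_
  rw [Finset.sum_const, nsmul_eq_mul, Finset.card_univ]
  apply le_of_eq
  ring

open Classical in
theorem edgeProb_subset_le {p : ℝ} (hp0 : 0 ≤ p) (hp1 : p ≤ 1) {D : Finset (Sym2 V)}
    (hD : ∀ e ∈ D, ¬ e.IsDiag) :
    edgeProb p (fun G : SimpleGraph V => ∀ e ∈ D, e ∈ G.edgeSet) ≤ p ^ D.card := by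
  have h := edgeExp_prod p hD (fun _ => (1 : ℝ)) (fun _ => 0)
  simp only [mul_one, mul_zero, add_zero, Finset.prod_const] at h
  rw [← h]
  refine edgeProb_le_edgeExp hp0 hp1 (fun G => Finset.prod_nonneg fun e _ => by
    split_ifs <;> norm_num) fun G hG => ?_
  rw [Finset.prod_eq_one fun e he => if_pos (hG e he)]

open Classical in
theorem edgeProb_card_filter_ge_le {p : ℝ} (hp0 : 0 ≤ p) (hp1 : p ≤ 1) {D : Finset (Sym2 V)}
    (hD : ∀ e ∈ D, ¬ e.IsDiag) (t : ℕ) :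
    edgeProb p (fun G : SimpleGraph V => t ≤ (D.filter fun e => e ∈ G.edgeSet).card) ≤
      D.card.choose t * p ^ t := by
  have h1 : edgeProb p (fun G : SimpleGraph V => t ≤ (D.filter fun e => e ∈ G.edgeSet).card) ≤
      edgeProb p (fun G : SimpleGraph V => ∃ K ∈ D.powersetCard t, ∀ e ∈ K, e ∈ G.edgeSet) := by
    refine edgeProb_mono hp0 hp1 fun G hG => ?_
    obtain ⟨K, hK, hKc⟩ := Finset.exists_subset_card_eq hG
    exact ⟨K, Finset.mem_powersetCard.2 ⟨hK.trans (Finset.filter_subset _ _), hKc⟩,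
      fun e he => (Finset.mem_filter.1 (hK he)).2⟩
  refine h1.trans ((edgeProb_exists_le hp0 hp1 _ _).trans ?_)
  have h2 : ∀ K ∈ D.powersetCard t, edgeProb p
      (fun G : SimpleGraph V => ∀ e ∈ K, e ∈ G.edgeSet) ≤ p ^ t := by
    intro K hK
    obtain ⟨hKD, hKc⟩ := Finset.mem_powersetCard.1 hK
    rw [← hKc]
    exact edgeProb_subset_le hp0 hp1 fun e he => hD e (hKD he)
  refine (Finset.sum_le_sum h2).trans ?_
  rw [Finset.sum_const, Finset.card_powersetCard, nsmul_eq_mul]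

open Classical in
/-- A lower-tail bound from the exponential moment at the weight `1 / 2`. -/
theorem edgeProb_card_filter_le_le {p : ℝ} (hp0 : 0 ≤ p) (hp1 : p ≤ 1) {D : Finset (Sym2 V)}
    (hD : ∀ e ∈ D, ¬ e.IsDiag) (t : ℕ) :
    edgeProb p (fun G : SimpleGraph V => (D.filter fun e => e ∈ G.edgeSet).card ≤ t) ≤
      2 ^ t * (1 - p / 2) ^ D.card := by
  have h := edgeExp_prod p hD (fun _ => (1 / 2 : ℝ)) (fun _ => 1)
  rw [Finset.prod_const, show p * (1 / 2) + (1 - p) * 1 = 1 - p / 2 by ring] at h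
  rw [← h, ← edgeExp_const_mul]
  have h1 : ∀ G : SimpleGraph V, (∏ e ∈ D, if e ∈ G.edgeSet then (1 / 2 : ℝ) else 1) =
      (1 / 2) ^ (D.filter fun e => e ∈ G.edgeSet).card := by
    intro G
    rw [Finset.prod_ite, Finset.prod_const, Finset.prod_const_one, mul_one]
  simp only [h1]
  refine edgeProb_le_edgeExp hp0 hp1 (fun G => by positivity) fun G hG => ?_
  rw [one_div, inv_pow, ← div_eq_mul_inv, one_le_div (by positivity)]
  exact pow_le_pow_right₀ (by norm_num) hG

open Classical in
/-- Union bound for dense small sets. -/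
theorem edgeProb_dense_le {p : ℝ} (hp0 : 0 ≤ p) (hp1 : p ≤ 1) (r M : ℕ) :
    edgeProb p (fun G : SimpleGraph V => ∃ U : Finset V, U.Nonempty ∧ U.card ≤ M ∧
        2 * r * U.card ≤ (G.interedges U U).card) ≤
      ∑ u ∈ Finset.Icc 1 M, ((Fintype.card V).choose u : ℝ) *
        (((u ^ 2).choose (r * u) : ℕ) * p ^ (r * u)) := by
  let D : Finset V → Finset (Sym2 V) := fun U => U.offDiag.image fun q => s(q.1, q.2)
  have hD : ∀ U, ∀ e ∈ D U, ¬ e.IsDiag := by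
    intro U e he
    obtain ⟨q, hq, rfl⟩ := Finset.mem_image.1 he
    rw [Sym2.mk_isDiag_iff]
    exact (Finset.mem_offDiag.1 hq).2.2
  have hDcard : ∀ U, (D U).card ≤ U.card ^ 2 := by
    intro U
    refine Finset.card_image_le.trans ?_
    rw [Finset.offDiag_card, sq]
    omega
  have hinter : ∀ (G : SimpleGraph V) U,
      (G.interedges U U).card ≤ 2 * ((D U).filter fun e => e ∈ G.edgeSet).card := by
    intro G U
    refine Finset.card_le_mul_card_image_of_maps_to (f := fun q : V × V => s(q.1, q.2)) ?_ 2 ?_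
    · rintro ⟨a, b⟩ hq
      rw [mk_mem_interedges_iff] at hq
      rw [Finset.mem_filter]
      exact ⟨Finset.mem_image.2 ⟨(a, b), Finset.mem_offDiag.2 ⟨hq.1, hq.2.1, hq.2.2.ne⟩, rfl⟩,
        hq.2.2⟩
    · intro e _
      induction e with | _ a b =>
      have : (G.interedges U U).filter (fun q : V × V => s(q.1, q.2) = s(a, b)) ⊆
          {(a, b), (b, a)} := by
        rintro ⟨a', b'⟩ hq
        have := (Finset.mem_filter.1 hq).2
        rw [Sym2.eq_iff] at this
        simp only [Finset.mem_insert, Finset.mem_singleton, Prod.mk.injEq]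
        exact this
      exact (Finset.card_le_card this).trans Finset.card_le_two
  have h1 : edgeProb p (fun G : SimpleGraph V => ∃ U : Finset V, U.Nonempty ∧ U.card ≤ M ∧
        2 * r * U.card ≤ (G.interedges U U).card) ≤
      edgeProb p (fun G : SimpleGraph V => ∃ u ∈ Finset.Icc 1 M, ∃ U ∈
        (Finset.univ : Finset V).powersetCard u,
        r * u ≤ ((D U).filter fun e => e ∈ G.edgeSet).card) := by
    refine edgeProb_mono hp0 hp1 fun G => ?_
    rintro ⟨U, hU, hUM, h⟩
    refine ⟨U.card, Finset.mem_Icc.2 ⟨hU.card_pos, hUM⟩, U,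
      Finset.mem_powersetCard.2 ⟨Finset.subset_univ _, rfl⟩, ?_⟩
    have := hinter G U
    have h' := h.trans this
    rw [mul_assoc] at h'
    omega
  refine h1.trans ((edgeProb_exists_le hp0 hp1 _ _).trans (Finset.sum_le_sum fun u _ => ?_))
  refine (edgeProb_exists_le hp0 hp1 _ _).trans ?_
  have h2 : ∀ U ∈ (Finset.univ : Finset V).powersetCard u, edgeProb p (fun G : SimpleGraph V =>
      r * u ≤ ((D U).filter fun e => e ∈ G.edgeSet).card) ≤
      ((u ^ 2).choose (r * u) : ℕ) * p ^ (r * u) := by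
    intro U hU
    have hUc := (Finset.mem_powersetCard.1 hU).2
    refine (edgeProb_card_filter_ge_le hp0 hp1 (hD U) (r * u)).trans ?_
    refine mul_le_mul_of_nonneg_right ?_ (by positivity)
    have := Nat.choose_le_choose (r * u) (hDcard U)
    rw [hUc] at this
    exact_mod_cast this
  refine (Finset.sum_le_sum h2).trans ?_
  rw [Finset.sum_const, Finset.card_powersetCard, nsmul_eq_mul, Finset.card_univ]

open Classical in
/-- Union bound for pairs of large sets with few edges between them. -/
theorem edgeProb_few_interedges_le {p : ℝ} (hp0 : 0 ≤ p) (hp1 : p ≤ 1) (t m : ℕ) :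
    edgeProb p (fun G : SimpleGraph V => ∃ A C : Finset V, 2 * m ≤ A.card ∧ 2 * m ≤ C.card ∧
        (G.interedges A C).card ≤ t) ≤
      4 ^ Fintype.card V * (2 ^ t * (1 - p / 2) ^ (m ^ 2)) := by
  let D : Finset V × Finset V → Finset (Sym2 V) := fun q => (q.1 ×ˢ q.2).image fun e => s(e.1, e.2)
  let T : Finset (Finset V × Finset V) := Finset.univ.filter fun q =>
    Disjoint q.1 q.2 ∧ q.1.card = m ∧ q.2.card = m
  have hinj : ∀ q ∈ T, Set.InjOn (fun e : V × V => s(e.1, e.2)) (q.1 ×ˢ q.2 : Finset (V × V)) := by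
    rintro ⟨A, C⟩ hq ⟨a, c⟩ h1 ⟨a', c'⟩ h2 h
    have hd := (Finset.mem_filter.1 hq).2.1
    simp only [Finset.coe_product, Set.mem_prod, Finset.mem_coe] at h1 h2
    rcases Sym2.eq_iff.1 h with h | h
    · rw [Prod.mk.injEq]
      exact h
    · have hac : a = c' := h.1
      rw [hac] at h1
      exact absurd h2.2 (Finset.disjoint_left.1 hd h1.1)
  have hDcard : ∀ q ∈ T, (D q).card = m ^ 2 := by
    intro q hq
    rw [Finset.card_image_of_injOn (hinj q hq), Finset.card_product,
      (Finset.mem_filter.1 hq).2.2.1, (Finset.mem_filter.1 hq).2.2.2, sq]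
  have h1 : edgeProb p (fun G : SimpleGraph V => ∃ A C : Finset V, 2 * m ≤ A.card ∧
        2 * m ≤ C.card ∧ (G.interedges A C).card ≤ t) ≤
      edgeProb p (fun G : SimpleGraph V => ∃ q ∈ T,
        ((D q).filter fun e => e ∈ G.edgeSet).card ≤ t) := by
    refine edgeProb_mono hp0 hp1 fun G => ?_
    rintro ⟨A, C, hA, hC, h⟩
    obtain ⟨A', hA', hA'c⟩ := Finset.exists_subset_card_eq (s := A) (n := m) (by omega)
    have hle := Finset.le_card_sdiff A' C
    obtain ⟨C', hC', hC'c⟩ := Finset.exists_subset_card_eq (s := C \ A') (n := m) (by omega)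
    refine ⟨(A', C'), Finset.mem_filter.2 ⟨Finset.mem_univ _, ?_, hA'c, hC'c⟩, ?_⟩
    · exact (Finset.disjoint_sdiff).mono_right hC'
    · refine le_trans ?_ h
      have : (D (A', C')).filter (fun e => e ∈ G.edgeSet) ⊆
          (G.interedges A C).image fun e => s(e.1, e.2) := by
        intro e he
        obtain ⟨he, heG⟩ := Finset.mem_filter.1 he
        obtain ⟨⟨a, c⟩, hac, rfl⟩ := Finset.mem_image.1 he
        rw [Finset.mem_product] at hac
        refine Finset.mem_image.2 ⟨(a, c), ?_, rfl⟩
        rw [mk_mem_interedges_iff]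
        exact ⟨hA' hac.1, (Finset.mem_sdiff.1 (hC' hac.2)).1, heG⟩
      exact (Finset.card_le_card this).trans Finset.card_image_le
  refine h1.trans ((edgeProb_exists_le hp0 hp1 _ _).trans ?_)
  have h2 : ∀ q ∈ T, edgeProb p (fun G : SimpleGraph V =>
      ((D q).filter fun e => e ∈ G.edgeSet).card ≤ t) ≤ 2 ^ t * (1 - p / 2) ^ (m ^ 2) := by
    intro q hq
    rw [← hDcard q hq]
    refine edgeProb_card_filter_le_le hp0 hp1 ?_ t
    intro e he
    obtain ⟨⟨a, c⟩, hac, rfl⟩ := Finset.mem_image.1 he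
    rw [Finset.mem_product] at hac
    rw [Sym2.mk_isDiag_iff]
    intro h
    have hac' : a = c := h
    rw [hac'] at hac
    exact Finset.disjoint_left.1 (Finset.mem_filter.1 hq).2.1 hac.1 hac.2
  refine (Finset.sum_le_sum h2).trans ?_
  rw [Finset.sum_const, nsmul_eq_mul]
  have hp2 : 0 ≤ 1 - p / 2 := by linarith
  refine mul_le_mul_of_nonneg_right ?_ (by positivity)
  have : T.card ≤ 4 ^ Fintype.card V := by
    refine (Finset.card_le_univ _).trans ?_
    rw [Fintype.card_prod, Fintype.card_finset, ← mul_pow]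
    norm_num
  exact_mod_cast this

open Classical in
/-- A cycle on `m + 3` vertices is given by an injective sequence, and needs `m + 3` edges. -/
theorem edgeExp_card_shortCycleHeads_le {p : ℝ} (hp0 : 0 ≤ p) (hp1 : p ≤ 1) (L : ℕ) :
    edgeExp p (fun G : SimpleGraph V => ((G.shortCycleHeads L).card : ℝ)) ≤
      ∑ m ∈ Finset.range L, (Fintype.card V * p) ^ (m + 3) := by
  let C : ∀ m : ℕ, (Fin (m + 3) → V) → Finset (Sym2 V) := fun m a =>
    Finset.univ.image fun i => s(a i, a (i + 1))
  let I : ∀ m : ℕ, Finset (Fin (m + 3) → V) := fun m =>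
    Finset.univ.filter fun a => Function.Injective a
  have hne : ∀ (m : ℕ) (i : Fin (m + 3)), i ≠ i + 1 := by
    intro m i h
    simp at h
  have hCcard : ∀ m, ∀ a ∈ I m, (C m a).card = m + 3 := by
    intro m a ha
    have hinj : Function.Injective a := (Finset.mem_filter.1 ha).2
    rw [Finset.card_image_of_injective]
    · simp
    · intro i j hij
      rcases Sym2.eq_iff.1 hij with h | h
      · exact hinj h.1
      · exfalso
        have h1 := hinj h.1
        have h2 := hinj h.2
        rw [h1, add_assoc] at h2
        have h3 : (1 + 1 : Fin (m + 3)) = 0 := by simpa using h2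
        have h4 := congrArg Fin.val h3
        rw [Fin.val_add] at h4
        simp only [Fin.val_one, Fin.val_zero] at h4
        rw [Nat.mod_eq_of_lt (by omega)] at h4
        omega
  have hpt : ∀ G : SimpleGraph V, ((G.shortCycleHeads L).card : ℝ) ≤ ∑ m ∈ Finset.range L,
      ∑ a ∈ I m, if (∀ e ∈ C m a, e ∈ G.edgeSet) then 1 else 0 := by
    intro G
    have hsub : G.shortCycleHeads L ⊆ (Finset.range L).biUnion fun m =>
        ((I m).filter fun a => ∀ e ∈ C m a, e ∈ G.edgeSet).image fun a => a 0 := by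
      intro v hv
      obtain ⟨-, l, ⟨hnd, h3, hch, x, hx, y, hy, hxy⟩, hL, hvl⟩ := Finset.mem_filter.1 hv
      obtain ⟨m, hm⟩ : ∃ m, l.length = m + 3 := ⟨l.length - 3, by omega⟩
      have hxv : x = v := by
        rw [Option.mem_def] at hx hvl
        rw [hx] at hvl
        exact Option.some.inj hvl
      subst hxv
      rw [Finset.mem_biUnion]
      refine ⟨m, Finset.mem_range.2 (by omega), ?_⟩
      rw [Finset.mem_image]
      have h0 : l[0]'(by omega) = x := by
        rw [List.head?_eq_getElem?, List.getElem?_eq_getElem (by omega)] at hx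
        simpa using hx
      have hlast : l[m + 2]'(by omega) = y := by
        rw [List.getLast?_eq_getElem?, List.getElem?_eq_getElem (by omega)] at hy
        simp only [Option.mem_def, Option.some.injEq, hm] at hy
        exact hy
      refine ⟨fun i => l[i.1]'(by omega), Finset.mem_filter.2 ⟨Finset.mem_filter.2
        ⟨Finset.mem_univ _, ?_⟩, ?_⟩, h0⟩
      · intro i j hij
        exact Fin.ext ((hnd.getElem_inj_iff).1 hij)
      · intro e he
        obtain ⟨i, -, rfl⟩ := Finset.mem_image.1 he
        rw [mem_edgeSet]
        by_cases hi : i = Fin.last (m + 2)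
        · subst hi
          have h1 : (Fin.last (m + 2) + 1 : Fin (m + 3)) = 0 := by simp
          simp only [h1, Fin.val_last, Fin.val_zero, h0, hlast]
          exact hxy
        · have h1 : ((i + 1 : Fin (m + 3)) : ℕ) = i.1 + 1 := by
            rw [Fin.val_add_one, if_neg hi]
          simp only [h1]
          have hi' : i.1 < m + 2 := Fin.val_lt_last hi
          exact List.isChain_iff_getElem.1 hch i.1 (by omega)
    have h1 : (G.shortCycleHeads L).card ≤ ∑ m ∈ Finset.range L,
        ((I m).filter fun a => ∀ e ∈ C m a, e ∈ G.edgeSet).card :=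
      (Finset.card_le_card hsub).trans (Finset.card_biUnion_le.trans
        (Finset.sum_le_sum fun m _ => Finset.card_image_le))
    have h2 : ((G.shortCycleHeads L).card : ℝ) ≤ ∑ m ∈ Finset.range L,
        (((I m).filter fun a => ∀ e ∈ C m a, e ∈ G.edgeSet).card : ℝ) := by exact_mod_cast h1
    refine h2.trans (le_of_eq (Finset.sum_congr rfl fun m _ => ?_))
    rw [Finset.card_filter]
    push_cast
    rfl
  refine (edgeExp_mono hp0 hp1 hpt).trans ?_
  rw [edgeExp_sum]
  refine Finset.sum_le_sum fun m _ => ?_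
  rw [edgeExp_sum]
  have h1 : ∀ a ∈ I m, edgeExp p (fun G : SimpleGraph V =>
      if (∀ e ∈ C m a, e ∈ G.edgeSet) then (1 : ℝ) else 0) ≤ p ^ (m + 3) := by
    intro a ha
    rw [← hCcard m a ha]
    have hd : ∀ e ∈ C m a, ¬ e.IsDiag := by
      intro e he
      obtain ⟨i, -, rfl⟩ := Finset.mem_image.1 he
      rw [Sym2.mk_isDiag_iff]
      intro h
      exact hne m i ((Finset.mem_filter.1 ha).2 h)
    have h2 := edgeProb_subset_le hp0 hp1 hd
    unfold edgeProb at h2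
    convert h2
  refine (Finset.sum_le_sum h1).trans ?_
  rw [Finset.sum_const, nsmul_eq_mul, mul_pow]
  refine mul_le_mul_of_nonneg_right ?_ (by positivity)
  have : (I m).card ≤ Fintype.card V ^ (m + 3) := by
    refine (Finset.card_le_univ _).trans ?_
    rw [Fintype.card_fun, Fintype.card_fin]
  exact_mod_cast this

end Estimates

end SimpleGraph

/-! ### Sparse random graphs: asymptotics -/

namespace SimpleGraph

section Whp

/-- The event `P n` holds with probability tending to one in the random graph with vertex set
`Fin n` and edge probability `c / n`. -/
def Whp (c : ℝ) (P : ∀ n : ℕ, SimpleGraph (Fin n) → Prop) : Prop :=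
  Tendsto (fun n : ℕ => edgeProb (c / n) fun G : SimpleGraph (Fin n) => ¬ P n G) atTop (𝓝 0)

variable {c : ℝ}

theorem eventually_edge_probability (hc : 0 ≤ c) :
    ∀ᶠ n : ℕ in atTop, (0 : ℝ) < n ∧ 0 ≤ c / n ∧ c / n ≤ 1 := by
  filter_upwards [eventually_ge_atTop (⌈c⌉₊ + 1)] with n hn
  have hn0 : (0 : ℝ) < n := by exact_mod_cast (by omega : 0 < n)
  refine ⟨hn0, div_nonneg hc hn0.le, (div_le_one hn0).2 ((Nat.le_ceil c).trans ?_)⟩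
  exact_mod_cast (by omega : ⌈c⌉₊ ≤ n)

theorem Whp.of_le (hc : 0 ≤ c) {P : ∀ n : ℕ, SimpleGraph (Fin n) → Prop} {u : ℕ → ℝ}
    (hu : Tendsto u atTop (𝓝 0)) (h : ∀ᶠ n : ℕ in atTop,
      edgeProb (c / n) (fun G : SimpleGraph (Fin n) => ¬ P n G) ≤ u n) : Whp c P := by
  refine tendsto_of_tendsto_of_tendsto_of_le_of_le' tendsto_const_nhds hu ?_ h
  filter_upwards [eventually_edge_probability hc] with n hn
  exact edgeProb_nonneg hn.2.1 hn.2.2 _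

theorem Whp.mono (hc : 0 ≤ c) {P Q : ∀ n : ℕ, SimpleGraph (Fin n) → Prop} (hP : Whp c P)
    (h : ∀ᶠ n : ℕ in atTop, ∀ G, P n G → Q n G) : Whp c Q := by
  refine Whp.of_le hc hP ?_
  filter_upwards [eventually_edge_probability hc, h] with n hn h
  exact edgeProb_mono hn.2.1 hn.2.2 fun G hQ hP => hQ (h G hP)

theorem Whp.and (hc : 0 ≤ c) {P Q : ∀ n : ℕ, SimpleGraph (Fin n) → Prop} (hP : Whp c P)
    (hQ : Whp c Q) : Whp c fun n G => P n G ∧ Q n G := by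
  have h := Tendsto.add hP hQ
  rw [add_zero] at h
  refine Whp.of_le hc h ?_
  filter_upwards [eventually_edge_probability hc] with n hn
  refine (edgeProb_mono hn.2.1 hn.2.2 fun G h => ?_).trans (edgeProb_or_le hn.2.1 hn.2.2 _ _)
  by_contra! h'
  exact h h'

theorem Whp.tendsto_gnp (hc : 0 ≤ c) {P : ∀ n : ℕ, SimpleGraph (Fin n) → Prop} (hP : Whp c P) :
    Tendsto (fun n : ℕ => gnp n (c / n) {G | P n G}) atTop (𝓝 1) := by
  have hprob : ∀ n, IsProbabilityMeasure (gnp n (c / n)) := fun n => by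
    unfold gnp
    infer_instance
  have h1 : Tendsto (fun n : ℕ => gnp n (c / n) {G | P n G}ᶜ) atTop (𝓝 0) := by
    have h2 := ENNReal.tendsto_ofReal hP
    rw [ENNReal.ofReal_zero] at h2
    refine h2.congr' ?_
    filter_upwards [eventually_edge_probability hc] with n hn
    rw [← ofReal_measureReal, gnp_real_apply n hn.2.1 hn.2.2]
    rfl
  have h3 : Tendsto (fun n : ℕ => 1 - gnp n (c / n) {G | P n G}ᶜ) atTop (𝓝 1) := by
    have := ENNReal.Tendsto.sub (tendsto_const_nhds (x := (1 : ENNReal)) (f := atTop (α := ℕ))) h1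
      (Or.inl ENNReal.one_ne_top)
    rwa [tsub_zero] at this
  refine tendsto_of_tendsto_of_tendsto_of_le_of_le h3 tendsto_const_nhds (fun n => ?_)
    fun n => prob_le_one
  have h4 := measure_union_le (μ := gnp n (c / n)) {G | P n G} {G | P n G}ᶜ
  rw [Set.union_compl_self, measure_univ] at h4
  exact tsub_le_iff_right.2 h4

/-- A parameter with bounded increments is within `o(n)` of its mean. -/
theorem whp_abs_sub_edgeExp_lt (hc : 0 ≤ c) (f : ∀ n : ℕ, SimpleGraph (Fin n) → ℝ) (C : ℝ)
    (hf : ∀ n (G : SimpleGraph (Fin n)) a b, a ≠ b →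
      |f n (G ⊔ edge a b) - f n (G \ edge a b)| ≤ C) {θ : ℝ} (hθ : 0 < θ) :
    Whp c fun n G => |f n G - edgeExp (c / n) (f n)| < θ * n := by
  have hu : Tendsto (fun n : ℕ => (c * C ^ 2 / θ ^ 2) / (n : ℝ)) atTop (𝓝 0) :=
    tendsto_const_div_atTop_nhds_zero_nat _
  refine Whp.of_le hc hu ?_
  filter_upwards [eventually_edge_probability hc] with n hn
  simp only [not_lt]
  refine (edgeProb_abs_sub_ge_le hn.2.1 hn.2.2 C (θ * n) (mul_pos hθ hn.1) (f n) (hf n)).trans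
    (le_of_eq ?_)
  have := hn.1.ne'
  rw [Fintype.card_fin]
  field_simp

/-- A parameter with bounded increments and mean `(a + o(1)) n` is `(a + o(1)) n`. -/
theorem whp_abs_sub_lt (hc : 0 ≤ c) (f : ∀ n : ℕ, SimpleGraph (Fin n) → ℝ) (C : ℝ)
    (hf : ∀ n (G : SimpleGraph (Fin n)) a b, a ≠ b →
      |f n (G ⊔ edge a b) - f n (G \ edge a b)| ≤ C) {a : ℝ}
    (ha : Tendsto (fun n : ℕ => edgeExp (c / n) (f n) / n) atTop (𝓝 a)) {θ : ℝ} (hθ : 0 < θ) :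
    Whp c fun n G => |f n G - a * n| < θ * n := by
  refine (whp_abs_sub_edgeExp_lt hc f C hf (half_pos hθ)).mono hc ?_
  filter_upwards [eventually_edge_probability hc, Metric.tendsto_nhds.1 ha _ (half_pos hθ)]
    with n hn h G hG
  rw [Real.dist_eq] at h
  have h1 : |edgeExp (c / n) (f n) - a * n| < θ / 2 * n := by
    have h2 := mul_lt_mul_of_pos_right h hn.1
    rwa [← abs_of_pos hn.1, ← abs_mul, abs_of_pos hn.1, sub_mul, div_mul_cancel₀ _ hn.1.ne'] at h2
  have h3 := abs_sub_le (f n G) (edgeExp (c / n) (f n)) (a * n)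
  linarith

theorem tendsto_one_sub_div_pow_sub (c : ℝ) (j : ℕ) :
    Tendsto (fun n : ℕ => (1 - c / n) ^ (n - j)) atTop (𝓝 (Real.exp (-c))) := by
  have h1 := Real.tendsto_one_add_div_pow_exp (-c)
  have h0 : Tendsto (fun n : ℕ => c / (n : ℝ)) atTop (𝓝 0) :=
    tendsto_const_div_atTop_nhds_zero_nat c
  have h2 : Tendsto (fun n : ℕ => (1 - c / (n : ℝ)) ^ j) atTop (𝓝 1) := by
    have := (h0.const_sub 1).pow j
    simpa using this
  have h3 := h1.div h2 one_ne_zero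
  rw [div_one] at h3
  refine h3.congr' ?_
  filter_upwards [eventually_ge_atTop j, h0.eventually (gt_mem_nhds one_pos)] with n hn hlt
  have h4 : (1 - c / (n : ℝ)) ≠ 0 := by linarith
  have h5 : 1 + -c / (n : ℝ) = 1 - c / n := by ring
  rw [Pi.div_apply, h5, div_eq_iff (pow_ne_zero _ h4), ← pow_add, Nat.sub_add_cancel hn]

theorem tendsto_pred_mul_div (c : ℝ) :
    Tendsto (fun n : ℕ => ((n - 1 : ℕ) : ℝ) * (c / n)) atTop (𝓝 c) := by
  have h0 : Tendsto (fun n : ℕ => c - c / (n : ℝ)) atTop (𝓝 (c - 0)) :=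
    (tendsto_const_div_atTop_nhds_zero_nat c).const_sub c
  rw [sub_zero] at h0
  refine h0.congr' ?_
  filter_upwards [eventually_ge_atTop 1] with n hn
  have : (n : ℝ) ≠ 0 := by exact_mod_cast (by omega : n ≠ 0)
  rw [Nat.cast_sub hn]
  field_simp
  simp

open Classical in
theorem tendsto_edgeExp_card_degree_eq_one (c : ℝ) :
    Tendsto (fun n : ℕ => edgeExp (c / n) (fun G : SimpleGraph (Fin n) =>
      ((Finset.univ.filter fun v => G.degree v = 1).card : ℝ)) / n) atTop
      (𝓝 (c * Real.exp (-c))) := by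
  refine ((tendsto_pred_mul_div c).mul (tendsto_one_sub_div_pow_sub c 2)).congr' ?_
  filter_upwards [eventually_ge_atTop 1] with n hn
  have : (n : ℝ) ≠ 0 := by exact_mod_cast (by omega : n ≠ 0)
  rw [edgeExp_card_degree_eq_one, Fintype.card_fin, mul_div_cancel_left₀ _ this]
  ring

theorem tendsto_edgeExp_defect (c : ℝ) :
    Tendsto (fun n : ℕ => edgeExp (c / n) (fun G : SimpleGraph (Fin n) => (G.defect : ℝ)) / n) atTop
      (𝓝 (c * Real.exp (-c) + 2 * Real.exp (-c))) := by
  refine (((tendsto_pred_mul_div c).mul (tendsto_one_sub_div_pow_sub c 2)).add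
    ((tendsto_one_sub_div_pow_sub c 1).const_mul 2)).congr' ?_
  filter_upwards [eventually_ge_atTop 1] with n hn
  have : (n : ℝ) ≠ 0 := by exact_mod_cast (by omega : n ≠ 0)
  rw [edgeExp_defect, Fintype.card_fin, mul_div_cancel_left₀ _ this]
  ring

/-- Asymptotic upper bound for the mean of `lowExcess`. -/
theorem eventually_edgeExp_lowExcess_le (hc : 0 ≤ c) {x : ℝ} (hx0 : 0 < x) (hx1 : x ≤ 1) (k : ℕ)
    {δ : ℝ} (hδ : c ^ 2 * ((x ^ (2 * k))⁻¹ * Real.exp (-((1 - x) * c)) ^ 2) < δ) :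
    ∀ᶠ n : ℕ in atTop, edgeExp (c / n) (fun G : SimpleGraph (Fin n) => (G.lowExcess k : ℝ)) ≤
      δ * n := by
  have h1 := (((tendsto_one_sub_div_pow_sub ((1 - x) * c) 3).pow 2).const_mul
    (x ^ (2 * k))⁻¹).const_mul (c ^ 2)
  filter_upwards [eventually_edge_probability hc, h1.eventually (gt_mem_nhds hδ)] with n hn h2
  refine (edgeExp_lowExcess_le hn.2.1 hn.2.2 hx0 hx1 k).trans ?_
  rw [Fintype.card_fin]
  have h3 : c / n * x + (1 - c / n) = 1 - (1 - x) * c / n := by ring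
  have h4 : ∀ y : ℝ, y ^ (2 * (n - 3)) = (y ^ (n - 3)) ^ 2 := fun y => by rw [mul_comm, pow_mul]
  rw [h3, h4 (1 - _)]
  generalize (1 - (1 - x) * c / (n : ℝ)) ^ (n - 3) = y at h2 ⊢
  refine le_trans (le_of_eq ?_) (mul_le_mul_of_nonneg_right h2.le hn.1.le)
  have := hn.1.ne'
  field_simp

theorem whp_card_shortCycleHeads_lt (hc : 0 ≤ c) (L : ℕ) {θ : ℝ} (hθ : 0 < θ) :
    Whp c fun n G => ((G.shortCycleHeads L).card : ℝ) < θ * n := by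
  have hu : Tendsto (fun n : ℕ => ((∑ m ∈ Finset.range L, c ^ (m + 3)) / θ) / (n : ℝ)) atTop
      (𝓝 0) :=
    tendsto_const_div_atTop_nhds_zero_nat _
  refine Whp.of_le hc hu ?_
  filter_upwards [eventually_edge_probability hc] with n hn
  simp only [not_lt]
  have hθn : 0 < θ * n := mul_pos hθ hn.1
  have h1 : edgeProb (c / n) (fun G : SimpleGraph (Fin n) => θ * n ≤ (G.shortCycleHeads L).card) ≤
      edgeExp (c / n) (fun G : SimpleGraph (Fin n) =>
        (θ * n)⁻¹ * ((G.shortCycleHeads L).card : ℝ)) := by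
    refine edgeProb_le_edgeExp hn.2.1 hn.2.2 (fun G => by positivity) fun G hG => ?_
    rw [inv_mul_eq_div, one_le_div hθn]
    exact hG
  refine h1.trans ?_
  rw [edgeExp_const_mul, div_div, inv_mul_eq_div]
  refine div_le_div_of_nonneg_right ?_ hθn.le
  refine (edgeExp_card_shortCycleHeads_le hn.2.1 hn.2.2 L).trans (le_of_eq ?_)
  rw [Fintype.card_fin, mul_div_cancel₀ _ hn.1.ne']

open Classical in
/-- Linear-size sets span many edges: the exponent `3 - c β² / 32` beats the number of pairs. -/
theorem whp_two_mul_card_le_card_interedges (hc : 0 < c) {β : ℝ} (hβ : 0 < β)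
    (hcβ : 128 ≤ c * β ^ 2) :
    Whp c fun n G => ∀ A C : Finset (Fin n), ⌊β * n⌋₊ ≤ A.card → ⌊β * n⌋₊ ≤ C.card →
      2 * n ≤ (G.interedges A C).card := by
  have hu : Tendsto (fun n : ℕ => Real.exp (-1) ^ n) atTop (𝓝 0) :=
    tendsto_pow_atTop_nhds_zero_of_lt_one (Real.exp_pos _).le
      (by rw [Real.exp_lt_one_iff]; norm_num)
  refine Whp.of_le hc.le hu ?_
  have hbig : ∀ᶠ n : ℕ in atTop, 4 / β ≤ (n : ℝ) :=
    tendsto_natCast_atTop_atTop.eventually (eventually_ge_atTop _)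
  filter_upwards [eventually_edge_probability hc.le, hbig] with n hn hnβ
  have hm : β * n / 4 ≤ ((⌊β * n⌋₊ / 2 : ℕ) : ℝ) := by
    have h1 := Nat.lt_floor_add_one (β * n)
    have h2 : ((⌊β * n⌋₊ : ℕ) : ℝ) ≤ 2 * ((⌊β * n⌋₊ / 2 : ℕ) : ℝ) + 1 := by
      exact_mod_cast (by omega : ⌊β * n⌋₊ ≤ 2 * (⌊β * n⌋₊ / 2) + 1)
    have h3 : 4 ≤ β * n := by
      rw [div_le_iff₀ hβ] at hnβ
      linarith
    linarith
  have h1 : edgeProb (c / n) (fun G : SimpleGraph (Fin n) => ¬ ∀ A C : Finset (Fin n),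
      ⌊β * n⌋₊ ≤ A.card → ⌊β * n⌋₊ ≤ C.card → 2 * n ≤ (G.interedges A C).card) ≤
      edgeProb (c / n) (fun G : SimpleGraph (Fin n) => ∃ A C : Finset (Fin n),
        2 * (⌊β * n⌋₊ / 2) ≤ A.card ∧ 2 * (⌊β * n⌋₊ / 2) ≤ C.card ∧
        (G.interedges A C).card ≤ 2 * n) := by
    refine edgeProb_mono hn.2.1 hn.2.2 fun G h => ?_
    push Not at h
    obtain ⟨A, C, hA, hC, h⟩ := h
    exact ⟨A, C, by omega, by omega, h.le⟩
  refine h1.trans ((edgeProb_few_interedges_le hn.2.1 hn.2.2 (2 * n) _).trans ?_)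
  rw [Fintype.card_fin]
  set m := ⌊β * n⌋₊ / 2
  have h2 : (1 - c / n / 2) ^ (m ^ 2) ≤ Real.exp (-4) ^ n := by
    have h3 : 1 - c / n / 2 ≤ Real.exp (-(c / n / 2)) := Real.one_sub_le_exp_neg _
    have h4 : 0 ≤ 1 - c / n / 2 := by linarith [hn.2.2]
    refine (pow_le_pow_left₀ h4 h3 _).trans ?_
    rw [← Real.exp_nat_mul, ← Real.exp_nat_mul, Real.exp_le_exp]
    push_cast
    have h5 : (β * n / 4) ^ 2 ≤ (m : ℝ) ^ 2 := pow_le_pow_left₀ (by positivity) hm 2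
    have h6 : (β * n / 4) ^ 2 * (c / n / 2) ≤ (m : ℝ) ^ 2 * (c / n / 2) :=
      mul_le_mul_of_nonneg_right h5 (by linarith [hn.2.1])
    have h7 : (β * n / 4) ^ 2 * (c / n / 2) = (c * β ^ 2) * n / 32 := by
      have := hn.1.ne'
      field_simp
      norm_num
    rw [h7] at h6
    nlinarith [hn.1]
  have h3 : (4 : ℝ) ^ n * (2 ^ (2 * n)) = 16 ^ n := by
    rw [pow_mul, ← mul_pow]
    norm_num
  have h8 : (16 : ℝ) ≤ Real.exp 3 := by
    have h9 := Real.exp_one_gt_d9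
    have h10 : Real.exp 3 = Real.exp 1 ^ 3 := by rw [← Real.exp_nat_mul]; norm_num
    rw [h10]
    have : (2.7 : ℝ) ^ 3 ≤ Real.exp 1 ^ 3 := pow_le_pow_left₀ (by norm_num) (by linarith) 3
    linarith
  rw [← mul_assoc, h3]
  calc (16 : ℝ) ^ n * (1 - c / n / 2) ^ (m ^ 2) ≤ Real.exp 3 ^ n * Real.exp (-4) ^ n := by
        refine mul_le_mul (pow_le_pow_left₀ (by norm_num) h8 n) h2 ?_ (by positivity)
        exact pow_nonneg (by linarith [hn.2.2]) _
    _ = Real.exp (-1) ^ n := by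
        rw [← mul_pow, ← Real.exp_add]
        norm_num

/-- One term of the union bound over dense sets of size `u`. -/
theorem choose_mul_choose_mul_pow_le {n u r : ℕ} (hn : 0 < n) (hu : 0 < u) (hr : 3 ≤ r) {c K : ℝ}
    (hc : 0 ≤ c) (hK : Real.exp 1 * c / r ≤ K) (h1 : K * (u / n) ≤ 1) :
    (n.choose u : ℝ) * (((u ^ 2).choose (r * u) : ℕ) * (c / n) ^ (r * u)) ≤
      (Real.exp 1 * K ^ 3 * (u / n) ^ 2) ^ u := by
  have hn' : (0 : ℝ) < n := by exact_mod_cast hn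
  have hu' : (0 : ℝ) < u := by exact_mod_cast hu
  have hr' : (0 : ℝ) < r := by exact_mod_cast (by omega : 0 < r)
  have hK0 : 0 ≤ K := le_trans (by positivity) hK
  have key : ∀ N t : ℕ, 0 < t → (N.choose t : ℝ) ≤ (Real.exp 1 * N / t) ^ t := by
    intro N t ht
    have ht' : (0 : ℝ) < t := by exact_mod_cast ht
    have h2 := Nat.choose_le_pow_div (α := ℝ) t N
    have h3 := Real.pow_div_factorial_le_exp (t : ℝ) ht'.le t
    refine h2.trans ?_
    have hf : (0 : ℝ) < (Nat.factorial t : ℝ) := by exact_mod_cast Nat.factorial_pos t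
    rw [div_le_iff₀ hf] at h3 ⊢
    rw [div_pow, mul_pow, ← Real.exp_nat_mul, mul_one, div_mul_eq_mul_div,
      le_div_iff₀ (by positivity)]
    calc (N : ℝ) ^ t * (t : ℝ) ^ t ≤ (N : ℝ) ^ t * (Real.exp t * (Nat.factorial t : ℝ)) :=
          mul_le_mul_of_nonneg_left h3 (by positivity)
      _ = _ := by ring
  have h2 := key n u hu
  have h3 := key (u ^ 2) (r * u) (by positivity)
  have h4 : (((u ^ 2).choose (r * u) : ℕ) : ℝ) * (c / n) ^ (r * u) ≤ ((K * (u / n)) ^ 3) ^ u := by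
    calc (((u ^ 2).choose (r * u) : ℕ) : ℝ) * (c / n) ^ (r * u)
        ≤ (Real.exp 1 * (u ^ 2 : ℕ) / (r * u : ℕ)) ^ (r * u) * (c / n) ^ (r * u) :=
          mul_le_mul_of_nonneg_right h3 (by positivity)
      _ = ((Real.exp 1 * c / r * (u / n)) ^ r) ^ u := by
          rw [← mul_pow, ← pow_mul]
          congr 1
          push_cast
          field_simp
      _ ≤ ((K * (u / n)) ^ r) ^ u := by gcongr
      _ ≤ ((K * (u / n)) ^ 3) ^ u :=
          pow_le_pow_left₀ (by positivity) (pow_le_pow_of_le_one (by positivity) h1 hr) _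
  calc (n.choose u : ℝ) * (((u ^ 2).choose (r * u) : ℕ) * (c / n) ^ (r * u))
      ≤ (Real.exp 1 * n / u) ^ u * ((K * (u / n)) ^ 3) ^ u :=
        mul_le_mul h2 h4 (by positivity) (by positivity)
    _ = _ := by
        rw [← mul_pow]
        congr 1
        field_simp

open Classical in
/-- Local sparsity: each term of the union bound is at most a constant over `n ^ 2`, where the
constant `1 / 4` leaves room for the factor `u ^ 2`. -/
theorem whp_card_interedges_self_lt (hc : 0 ≤ c) {r : ℕ} (hr : 3 ≤ r) {K β : ℝ} (hβ : 0 < β)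
    (hK : Real.exp 1 * c / r ≤ K) (h1 : K * (2 * β) ≤ 1)
    (h2 : Real.exp 1 * K ^ 3 * (2 * β) ^ 2 ≤ 1 / 4) (hβ1 : 2 * β ≤ 1) :
    Whp c fun n G => ∀ U : Finset (Fin n), U.Nonempty → U.card ≤ 2 * ⌊β * n⌋₊ →
      (G.interedges U U).card < 2 * r * U.card := by
  have hu : Tendsto (fun n : ℕ => (4 * (Real.exp 1 * K ^ 3)) / (n : ℝ)) atTop (𝓝 0) :=
    tendsto_const_div_atTop_nhds_zero_nat _
  refine Whp.of_le hc hu ?_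
  filter_upwards [eventually_edge_probability hc] with n hn
  have hK0 : 0 ≤ K := le_trans (by positivity) hK
  have hM : ((2 * ⌊β * n⌋₊ : ℕ) : ℝ) ≤ 2 * β * n := by
    have := Nat.floor_le (mul_nonneg hβ.le hn.1.le)
    push_cast
    linarith
  have h3 : edgeProb (c / n) (fun G : SimpleGraph (Fin n) => ¬ ∀ U : Finset (Fin n), U.Nonempty →
      U.card ≤ 2 * ⌊β * n⌋₊ → (G.interedges U U).card < 2 * r * U.card) ≤
      edgeProb (c / n) (fun G : SimpleGraph (Fin n) => ∃ U : Finset (Fin n), U.Nonempty ∧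
        U.card ≤ 2 * ⌊β * n⌋₊ ∧ 2 * r * U.card ≤ (G.interedges U U).card) := by
    refine edgeProb_mono hn.2.1 hn.2.2 fun G h => ?_
    push Not at h
    exact h
  refine h3.trans ((edgeProb_dense_le hn.2.1 hn.2.2 r _).trans ?_)
  rw [Fintype.card_fin]
  have h4 : ∀ u ∈ Finset.Icc 1 (2 * ⌊β * n⌋₊), (n.choose u : ℝ) *
      (((u ^ 2).choose (r * u) : ℕ) * (c / n) ^ (r * u)) ≤
      4 * (Real.exp 1 * K ^ 3) / (n : ℝ) ^ 2 := by
    intro u hu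
    obtain ⟨hu1, hu2⟩ := Finset.mem_Icc.1 hu
    have hun : (u : ℝ) / n ≤ 2 * β := by
      rw [div_le_iff₀ hn.1]
      exact le_trans (by exact_mod_cast hu2) hM
    refine (choose_mul_choose_mul_pow_le (by exact_mod_cast hn.1) hu1 hr hc hK
      ((mul_le_mul_of_nonneg_left hun hK0).trans h1)).trans ?_
    set y := Real.exp 1 * K ^ 3 * (u / n) ^ 2 with hy
    have hy0 : 0 ≤ y := by positivity
    have hy1 : y ≤ 1 / 4 := le_trans (by rw [hy]; gcongr) h2
    obtain ⟨v, rfl⟩ : ∃ v, u = v + 1 := ⟨u - 1, by omega⟩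
    have h5 : y ^ v ≤ (1 / 4) ^ v := pow_le_pow_left₀ hy0 hy1 v
    have h6 : ((v + 1 : ℕ) : ℝ) ^ 2 ≤ 4 * 4 ^ v := by
      have h7 : v + 1 ≤ 2 ^ (v + 1) := Nat.lt_two_pow_self.le
      have h8 : (v + 1) ^ 2 ≤ (2 ^ (v + 1)) ^ 2 := Nat.pow_le_pow_left h7 2
      have h9 : (2 ^ (v + 1)) ^ 2 = 4 * 4 ^ v := by
        rw [← pow_mul, mul_comm, pow_mul]
        norm_num [pow_succ, mul_comm]
      rw [h9] at h8
      exact_mod_cast h8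
    calc y ^ (v + 1) = y ^ v * y := pow_succ _ _
      _ ≤ (1 / 4) ^ v * y := mul_le_mul_of_nonneg_right h5 hy0
      _ = (1 / 4) ^ v * (Real.exp 1 * K ^ 3 / (n : ℝ) ^ 2) * ((v + 1 : ℕ) : ℝ) ^ 2 := by
          rw [hy]
          ring
      _ ≤ (1 / 4) ^ v * (Real.exp 1 * K ^ 3 / (n : ℝ) ^ 2) * (4 * 4 ^ v) :=
          mul_le_mul_of_nonneg_left h6 (by positivity)
      _ = 4 * (Real.exp 1 * K ^ 3) / (n : ℝ) ^ 2 := by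
          rw [one_div, inv_pow]
          field_simp
  refine (Finset.sum_le_sum h4).trans ?_
  rw [Finset.sum_const, nsmul_eq_mul, Nat.card_Icc, Nat.add_sub_cancel]
  have h5 : ((2 * ⌊β * n⌋₊ : ℕ) : ℝ) ≤ n := hM.trans (by nlinarith [hn.1])
  calc ((2 * ⌊β * n⌋₊ : ℕ) : ℝ) * (4 * (Real.exp 1 * K ^ 3) / (n : ℝ) ^ 2)
      ≤ n * (4 * (Real.exp 1 * K ^ 3) / (n : ℝ) ^ 2) :=
        mul_le_mul_of_nonneg_right h5 (by positivity)
    _ = 4 * (Real.exp 1 * K ^ 3) / n := by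
        have := hn.1.ne'
        field_simp

end Whp

end SimpleGraph

/-! ### The path cover number of a sparse random graph -/

namespace SimpleGraph

section PathCover

open Classical in
/-- The number of vertices of degree one is at least `(1 - o(1)) c e⁻ᶜ n`. -/
theorem whp_le_card_degree_eq_one {c ε : ℝ} (hc : 0 < c) (hε : 0 < ε) :
    Whp c fun n G => (1 - ε) * (c * Real.exp (-c)) * n ≤
      ((Finset.univ.filter fun v => G.degree v = 1).card : ℝ) := by
  have hδ : 0 < ε * (c * Real.exp (-c)) := by positivity
  have h := whp_abs_sub_lt hc.le (fun n (G : SimpleGraph (Fin n)) =>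
    ((Finset.univ.filter fun v => G.degree v = 1).card : ℝ)) 2 (fun n G a b _ => by
      have := abs_sum_degree_sub_le (fun d => if d = 1 then 1 else 0) (fun d => by
        rcases d with _ | _ | d <;> simp) G a b
      simp only [Finset.card_filter]
      push_cast
      convert this) (tendsto_edgeExp_card_degree_eq_one c) hδ
  refine h.mono hc.le (Eventually.of_forall fun n G hG => ?_)
  have := (abs_lt.1 hG).1
  linarith

/-- A path cover, as well as a set of edges whose addition makes the graph Hamiltonian, takes care
of at most two vertices of degree one per path or edge. -/
theorem whp_le_pathCoverNumber {c ε : ℝ} (hc : 0 < c) (hε : 0 < ε) :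
    Whp c fun n G => (1 - ε) * (1 / 2 * c * Real.exp (-c)) * n ≤ (G.pathCoverNumber : ℝ) ∧
      ∀ H : SimpleGraph (Fin n), (G ⊔ H).IsHamiltonian →
        (1 - ε) * (1 / 2 * c * Real.exp (-c)) * n ≤ (H.edgeSet.ncard : ℝ) := by
  classical
  refine (whp_le_card_degree_eq_one hc hε).mono hc.le ?_
  filter_upwards [eventually_ge_atTop 3] with n hn G hG
  have h3 : 3 ≤ Fintype.card (Fin n) := by rwa [Fintype.card_fin]
  have hlow : ∀ j : ℕ, (Finset.univ.filter fun v => G.degree v = 1).card ≤ 2 * j →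
      (1 - ε) * (1 / 2 * c * Real.exp (-c)) * n ≤ (j : ℝ) := by
    intro j hj
    have hj' : ((Finset.univ.filter fun v => G.degree v = 1).card : ℝ) ≤ 2 * j := by
      exact_mod_cast hj
    have hj'' := hG.trans (le_trans (le_of_eq (by congr)) hj')
    linarith
  refine ⟨hlow _ ?_, fun H hH => hlow _ ?_⟩
  · convert card_degree_eq_one_le_pathCoverNumber G h3
  · have := card_degree_eq_one_le_of_isHamiltonian (G := G) (H := H) (by convert hH) h3
    convert this

theorem whp_defect_lt {c θ : ℝ} (hc : 0 < c) (hθ : 0 < θ) :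
    Whp c fun n G => (G.defect : ℝ) < (c * Real.exp (-c) + 2 * Real.exp (-c) + θ) * n := by
  have h := whp_abs_sub_lt hc.le (fun n (G : SimpleGraph (Fin n)) => (G.defect : ℝ)) 2
    (fun n G a b _ => by
      have := abs_sum_degree_sub_le (fun d => ((2 - d : ℕ) : ℝ)) (fun d => by
        rcases d with _ | _ | d <;> norm_num) G a b
      unfold defect
      rw [Nat.cast_sum, Nat.cast_sum]
      convert this <;> rfl) (tendsto_edgeExp_defect c) hθ
  refine h.mono hc.le (Eventually.of_forall fun n G hG => ?_)
  have := (abs_lt.1 hG).2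
  linarith

theorem whp_lowExcess_lt {c δ θ x : ℝ} (hc : 0 < c) (hθ : 0 < θ) (hx0 : 0 < x) (hx1 : x ≤ 1) (k : ℕ)
    (hδ : c ^ 2 * ((x ^ (2 * k))⁻¹ * Real.exp (-((1 - x) * c)) ^ 2) < δ) :
    Whp c fun n G => (G.lowExcess k : ℝ) < (δ + θ) * n := by
  have h := whp_abs_sub_edgeExp_lt hc.le (fun n (G : SimpleGraph (Fin n)) => (G.lowExcess k : ℝ))
    (2 * k) (fun n G a b _ => abs_lowExcess_sub_le k G a b) hθ
  refine h.mono hc.le ?_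
  filter_upwards [eventually_edgeExp_lowExcess_le hc.le hx0 hx1 k hδ] with n hn G hG
  have := (abs_lt.1 hG).2
  linarith

open Classical in
/-- A path cover and a Hamiltonian completion with few paths and edges, for large `c`. The cut
condition is used with `d = defect + lowExcess ⌊c / 15⌋`, whose mean is about `c e⁻ᶜ n`. -/
theorem whp_exists_cover {c ε : ℝ} (hε : 0 < ε) (hc : 2 * 10 ^ 12 ≤ c) (hcε : 200 ≤ ε * c) :
    Whp c fun n G => ∃ k, G.HasPathCover k ∧
      (∃ H : SimpleGraph (Fin n), (G ⊔ H).IsHamiltonian ∧ H.edgeSet.ncard ≤ k) ∧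
      (k : ℝ) ≤ (1 + ε) * (1 / 2 * c * Real.exp (-c)) * n := by
  have hc0 : 0 < c := by linarith
  set E := Real.exp (-c) with hE
  have hE0 : 0 < E := Real.exp_pos _
  -- the allowed excess over `c * E * n / 2` is `10 * δ * n`
  set δ := ε * (c * E) / 20 with hδ
  have hδ0 : 0 < δ := by positivity
  obtain ⟨k, hk⟩ : ∃ k, k = ⌊c / 15⌋₊ := ⟨_, rfl⟩
  have hk1 : (k : ℝ) ≤ c / 15 := hk ▸ Nat.floor_le (by positivity)
  have hk2 : c / 15 < k + 1 := hk ▸ Nat.lt_floor_add_one _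
  obtain ⟨r, hr⟩ : ∃ r, r = k / 6 := ⟨_, rfl⟩
  have hr1 : c / 100 ≤ (r : ℝ) := by
    have : (k : ℝ) ≤ 6 * r + 5 := by exact_mod_cast (by omega : k ≤ 6 * r + 5)
    linarith
  have hr3 : 3 ≤ r := by
    have : (3 : ℝ) ≤ r := by linarith
    exact_mod_cast this
  -- cycles with more than `L` vertices contribute at most `2 * n / L ≤ δ * n`
  obtain ⟨L, hL⟩ : ∃ L : ℕ, L = ⌈2 / δ⌉₊ := ⟨_, rfl⟩
  have hL1 : 2 ≤ δ * L := by
    have := Nat.le_ceil (2 / δ)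
    rw [← hL, div_le_iff₀ hδ0] at this
    linarith
  have hL0 : (0 : ℝ) < L := by
    by_contra! h
    nlinarith
  have he := Real.exp_one_lt_d9
  -- with the weight `x = e⁻³` the exponent is `6 * c / 15 - 2 * (1 - x) * c ≤ - (1 + 2 / 5) * c`
  have hlow : c ^ 2 * ((Real.exp (-3) ^ (2 * k))⁻¹ *
      Real.exp (-((1 - Real.exp (-3)) * c)) ^ 2) < 2 * δ := by
    have hx : Real.exp (-3) ≤ 1 / 10 := by
      have h1 : Real.exp 3 = Real.exp 1 ^ 3 := by rw [← Real.exp_nat_mul]; norm_num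
      have h2 : (2.7 : ℝ) ^ 3 ≤ Real.exp 1 ^ 3 :=
        pow_le_pow_left₀ (by norm_num) (by linarith [Real.exp_one_gt_d9]) 3
      rw [Real.exp_neg, h1, ← one_div]
      exact one_div_le_one_div_of_le (by norm_num) (le_trans (by norm_num) h2)
    have h1 : (Real.exp (-3) ^ (2 * k))⁻¹ * Real.exp (-((1 - Real.exp (-3)) * c)) ^ 2 ≤
        E * Real.exp (-(2 / 5 * c)) := by
      rw [← Real.exp_nat_mul, ← Real.exp_neg, ← Real.exp_nat_mul, hE, ← Real.exp_add,
        ← Real.exp_add, Real.exp_le_exp]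
      push_cast
      nlinarith
    have h2 : c ^ 2 * Real.exp (-(2 / 5 * c)) ≤ 25 / 2 := by
      have h3 := Real.quadratic_le_exp_of_nonneg (x := 2 / 5 * c) (by positivity)
      rw [Real.exp_neg, ← div_eq_mul_inv, div_le_iff₀ (Real.exp_pos _)]
      nlinarith
    calc _ ≤ c ^ 2 * (E * Real.exp (-(2 / 5 * c))) := mul_le_mul_of_nonneg_left h1 (by positivity)
      _ = E * (c ^ 2 * Real.exp (-(2 / 5 * c))) := by ring
      _ ≤ E * (25 / 2) := mul_le_mul_of_nonneg_left h2 hE0.le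
      _ < E * (ε * c / 10) := mul_lt_mul_of_pos_left (by linarith) hE0
      _ = 2 * δ := by
          rw [hδ]
          ring
  have h2E : 2 * E ≤ 2 * δ := by
    have : E * 20 ≤ E * (ε * c) := mul_le_mul_of_nonneg_left (by linarith) hE0.le
    rw [hδ]
    linarith
  -- `e * c / r ≤ 100 * e < 300`, so a set size `β * n` with `β = 10⁻⁵` is locally sparse
  have hdense := whp_card_interedges_self_lt hc0.le hr3 (K := 300) (β := 1 / 10 ^ 5) (by norm_num)
    (by
      rw [div_le_iff₀ (by linarith)]
      nlinarith) (by norm_num) (by norm_num; linarith) (by norm_num)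
  have hlarge := whp_two_mul_card_le_card_interedges hc0 (β := 1 / 10 ^ 5) (by norm_num)
    (by norm_num; linarith)
  have hall := (((hdense.and hc0.le hlarge).and hc0.le (whp_defect_lt hc0 hδ0)).and hc0.le
    (whp_lowExcess_lt hc0 hδ0 (Real.exp_pos (-3)) (by rw [Real.exp_le_one_iff]; norm_num) k
      hlow)).and hc0.le (whp_card_shortCycleHeads_lt hc0.le L hδ0)
  refine hall.mono hc0.le ?_
  filter_upwards [eventually_ge_atTop 3] with n hn G hG
  obtain ⟨⟨⟨⟨hG1, hG2⟩, hG3⟩, hG4⟩, hG5⟩ := hG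
  have hcut := cut_le G (k := k) (r := r) (m := ⌊1 / 10 ^ 5 * (n : ℝ)⌋₊) (by omega) (by omega)
    (fun U h1 h2 => by convert hG1 U h1 h2) (fun A C h1 h2 => by
      rw [Fintype.card_fin]
      convert hG2 A C h1 h2)
  obtain ⟨j, hj1, ⟨H, hH1, hH2⟩, hj3⟩ := exists_cover_of_cut G (G.defect + G.lowExcess k) L
    (G.shortCycleHeads L) (exists_mem_shortCycleHeads G L) (fun A B => by convert hcut A B)
    (by rw [Fintype.card_fin]; exact hn)
  refine ⟨j, hj1, ⟨H, by convert hH1, hH2⟩, ?_⟩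
  rw [Fintype.card_fin] at hj3
  have hn0 : (0 : ℝ) < n := by exact_mod_cast (by omega : 0 < n)
  have h1 : 2 * (L : ℝ) * j ≤ L * (G.defect + G.lowExcess k) + 4 * n +
      4 * L * (G.shortCycleHeads L).card := by exact_mod_cast hj3
  have h2 : (4 : ℝ) * n ≤ L * (2 * δ * n) := by nlinarith
  have h3 : (L : ℝ) * (2 * j) ≤ L * ((G.defect + G.lowExcess k) + 2 * δ * n +
      4 * (G.shortCycleHeads L).card) := by linarith
  have h4 := le_of_mul_le_mul_left h3 hL0
  have h5 : 2 * E * n ≤ 2 * δ * n := mul_le_mul_of_nonneg_right h2E hn0.le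
  have h6 : (1 + ε) * (1 / 2 * c * E) * n = c * E * n / 2 + 10 * (δ * n) := by
    rw [hδ]
    ring
  have h7 : 0 < δ * n := mul_pos hδ0 hn0
  rw [h6]
  linarith

end PathCover

end SimpleGraph

theorem theorem1 (ε : ℝ) (hε : 0 < ε) :
    ∃ c₀ : ℝ, 0 < c₀ ∧ ∀ c : ℝ, c₀ ≤ c →
      Tendsto
        (fun n : ℕ => SimpleGraph.gnp n (c / n)
          {G : SimpleGraph (Fin n) |
            -- bounds on the path cover number
            ((1 - ε) * (1 / 2 * c * Real.exp (-c)) * n ≤ (G.pathCoverNumber : ℝ) ∧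
              (G.pathCoverNumber : ℝ) ≤ (1 + ε) * (1 / 2 * c * Real.exp (-c)) * n) ∧
            -- bounds on the number of added edges that suffice and that are needed
            ((∃ H : SimpleGraph (Fin n), (G ⊔ H).IsHamiltonian ∧
                (H.edgeSet.ncard : ℝ) ≤ (1 + ε) * (1 / 2 * c * Real.exp (-c)) * n) ∧
              ∀ H : SimpleGraph (Fin n), (G ⊔ H).IsHamiltonian →
                (1 - ε) * (1 / 2 * c * Real.exp (-c)) * n ≤ (H.edgeSet.ncard : ℝ))})
        atTop (𝓝 1) := by
  refine ⟨2 * 10 ^ 12 + 200 / ε, by positivity, fun c hc => ?_⟩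
  have hε' : 0 < 200 / ε := by positivity
  have hc1 : 2 * 10 ^ 12 ≤ c := by linarith
  have hc0 : 0 < c := by linarith
  have hcε : 200 ≤ ε * c := by
    have : 200 / ε ≤ c := by linarith
    rw [div_le_iff₀ hε] at this
    linarith
  apply SimpleGraph.Whp.tendsto_gnp hc0.le
  refine ((SimpleGraph.whp_le_pathCoverNumber hc0 hε).and hc0.le
    (SimpleGraph.whp_exists_cover hε hc1 hcε)).mono hc0.le (Eventually.of_forall fun n G hG => ?_)
  obtain ⟨⟨h1, h2⟩, k, hk1, ⟨H, hH1, hH2⟩, hk2⟩ := hG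
  exact ⟨⟨h1, le_trans (by exact_mod_cast SimpleGraph.pathCoverNumber_le hk1) hk2⟩,
    ⟨H, hH1, le_trans (by exact_mod_cast hH2) hk2⟩, h2⟩
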